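/- Let $r\ge 1$ and let $\mathcal X_1,\dots,\mathcal X_r$, $\mathcal Y_1,\dots,\mathcal Y_r$ and $\mathcal Z_r$ be (nonzero, finite-dimensional) complex Euclidean spaces; write $\mathcal X_{1..j}=\mathcal X_1\otimes\cdots\otimes\mathcal X_j$, and similarly $\mathcal Y_{1..j}$. An $r$-round pure strategy $\tilde A$ with final memory space $\mathcal Z_r$ is a tuple of linear isometries $A_i:\mathcal X_i\otimes\mathcal Z_{i-1}\to\mathcal Y_i\otimes\mathcal Z_i$ ($1\le i\le r$), where $\mathcal Z_0=\mathbb C$ and the intermediate memory spaces $\mathcal Z_1,\dots,\mathcal Z_{r-1}$ are arbitrary. Composing along the memory gives one isometry $\tilde A:\mathcal X_{1..r}\to\mathcal Y_{1..r}\otimes\mathcal Z_r$; the corresponding strategy $A$ is the Choi–Jamiołkowski operator on $\mathcal Y_{1..r}\otimes\mathcal X_{1..r}$ of the channel $\rho\mapsto\mathrm{Tr}_{\mathcal Z_r}(\tilde A\rho\tilde A^*)$, and $\tilde A$ is called a purification of $A$. An $r$-round pure co-strategy $\tilde B$ consists of a unit vector $|\beta\rangle\in\mathcal X_1\otimes\mathcal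 W_0$ and linear isometries $B_i:\mathcal Y_i\otimes\mathcal W_{i-1}\to\mathcal X_{i+1}\otimes\mathcal W_i$ ($1\le i\le r$), where $\mathcal X_{r+1}=\mathbb C$ and the spaces $\mathcal W_0,\dots,\mathcal W_r$ are arbitrary. The final state of the interaction is $$|\psi(\tilde A,\tilde B)\rangle=(I\otimes B_r)(A_r\otimes I)\cdots(I\otimes B_1)(A_1\otimes I)|\beta\rangle\in\mathcal Z_r\otimes\mathcal W_r,$$ and $\rho_A(\tilde B)=\mathrm{Tr}_{\mathcal Z_r}|\psi(\tilde A,\tilde B)\rangle\langle\psi(\tilde A,\tilde B)|$, which does not depend on the purification $\tilde A$ of $A$. With $F(P,Q)=\|\sqrt P\sqrt Q\|_1$ ($\|\cdot\|_1$ the trace norm), the strategy fidelity of two $r$-round strategies $S,T$ is $$F_r(S,T)=\min_{\tilde B}F\big(\rho_S(\tilde B),\rho_T(\tilde B)\big),$$ the minimum, which is attained, being over all $r$-round pure co-strategies. For a pure strategy $\tilde A$ let $|\tilde A\rangle\rangle\in\mathcal Z_r\otimes\mathcal Y_{1..r}\otimes\mathcal X_{1..r}$ be the vectorization of its isometry (the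 linear extension of $|y\rangle\langle x|\mapsto|y\rangle|x\rangle$ in the standard bases) and $\langle\langle\tilde A|$ the adjoint of $|\tilde A\rangle\rangle$. **Theorem.** Let $S$ and $T$ be $r$-round strategies, and let $\tilde S$ and $\tilde T$ be any purifications of $S$ and $T$, respectively, with the same final memory space $\mathcal Z_r$. Then $F_r(S,T)$ is equal to the optimal value, which is attained, of the following semidefinite program: $$\begin{array}{rl} \max & t\\ \text{subject to} & t\,I_{\mathcal X_1}\preceq\mathrm{Tr}_{\mathcal Y_1}(R_1),\\ & R_j\otimes I_{\mathcal X_{j+1}}\preceq\mathrm{Tr}_{\mathcal Y_{j+1}}(R_{j+1})\quad\text{for } j\in\{1,\dots,r-1\},\\ & R_r\preceq\tfrac12\,\mathrm{Tr}_{\mathcal Z_r}\big((K\otimes I_{\mathcal Y_{1..r}\otimes\mathcal X_{1..r}})|\tilde T\rangle\rangle\langle\langle\tilde S|\big)+\text{h.c.},\\ & \begin{pmatrix} I_{\mathcal Z_r}&K\\K^*&I_{\mathcal Z_r}\end{pmatrix}\succeq0, \end{array}$$ where the variables are $t\in\mathbb R$, Hermitian operators $R_j$ on $\mathcal Y_{1..j}\otimes\mathcal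 X_{1..j}$ for $j\in\{1,\dots,r\}$, and an arbitrary (not necessarily Hermitian) operator $K$ on $\mathcal Z_r$, and h.c. denotes the Hermitian conjugate of the preceding term. -/

import Mathlib

open scoped Matrix Kronecker ComplexOrder MatrixOrder

/-! ## Finite-dimensional linear algebra

A complex Euclidean space is `ℂ^ι` for a finite index type `ι`, an operator is a matrix, and a tensor
product of spaces is indexed by the product of the index types. -/

/-- Partial trace over the first tensor factor. -/
def trFirst {ι κ : Type*} [Fintype ι] (M : Matrix (ι × κ) (ι × κ) ℂ) : Matrix κ κ ℂ :=
  Matrix.of fun a b => ∑ i, M (i, a) (i, b)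

/-- Partial trace over the second tensor factor. -/
def trSecond {ι κ : Type*} [Fintype ι] (M : Matrix (κ × ι) (κ × ι) ℂ) : Matrix κ κ ℂ :=
  Matrix.of fun a b => ∑ i, M (a, i) (b, i)

/-- The trace norm `‖A‖₁ = Tr √(A* A)`. -/
noncomputable def traceNorm {ι : Type*} [Fintype ι] [DecidableEq ι] (A : Matrix ι ι ℂ) : ℝ :=
  (CFC.sqrt (Aᴴ * A)).trace.re

/-- The fidelity `F(P, Q) = ‖√P √Q‖₁` of positive semidefinite operators. -/
noncomputable def fidelity {ι : Type*} [Fintype ι] [DecidableEq ι] (P Q : Matrix ι ι ℂ) : ℝ :=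
  traceNorm (CFC.sqrt P * CFC.sqrt Q)

/-- The Choi-Jamiolkowski representation `∑ᵢⱼ Φ(|i⟩⟨j|) ⊗ |i⟩⟨j|` of a map on operators. -/
def choi {ι κ : Type*} [Fintype ι] [DecidableEq ι] (Φ : Matrix ι ι ℂ → Matrix κ κ ℂ) :
    Matrix (κ × ι) (κ × ι) ℂ :=
  ∑ i, ∑ j, Φ (Matrix.single i j 1) ⊗ₖ Matrix.single i j 1

/-- The index type of the tensor product of the first `k` spaces of a sequence of spaces; the spaces
are numbered from `0`. -/
abbrev Hist (X : ℕ → Type*) (k : ℕ) : Type _ := (i : Fin k) → X i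

/-! ## Strategies and co-strategies -/

section Strategies

variable (X Y : ℕ → Type*) [∀ i, Fintype (X i)] [∀ i, DecidableEq (X i)]
  [∀ i, Fintype (Y i)] [∀ i, DecidableEq (Y i)]

/-- `PureStrategy X Y r z`: the `r`-round pure strategies with input spaces `X 0, …, X (r - 1)`, output
spaces `Y 0, …, Y (r - 1)` and final memory space `ℂ^z`. Such a strategy is a tuple of `r` isometries,
the `i`-th one mapping (input `i`) ⊗ (old memory) to (output `i`) ⊗ (new memory); the memory before
the first round is `ℂ`, and the intermediate memories have arbitrary dimensions. -/
inductive PureStrategy : ℕ → ℕ → Type _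
  | nil : PureStrategy 0 1
  | snoc {r z z' : ℕ} (P : PureStrategy r z)
      (A : Matrix (Y r × Fin z') (X r × Fin z) ℂ) (isometry : Aᴴ * A = 1) :
      PureStrategy (r + 1) z'

/-- `PureCoPrefix X Y k w`: the first part of a pure co-strategy, consisting of the initial state and
the first `k` isometries, after which the message `X k` has been sent and the memory is `ℂ^w`. -/
inductive PureCoPrefix : ℕ → ℕ → Type _
  | start {w : ℕ} (β : X 0 × Fin w → ℂ) (unit : ∑ p, ‖β p‖ ^ 2 = 1) : PureCoPrefix 0 w
  | snoc {k w w' : ℕ} (P : PureCoPrefix k w)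
      (B : Matrix (X (k + 1) × Fin w') (Y k × Fin w) ℂ) (isometry : Bᴴ * B = 1) :
      PureCoPrefix (k + 1) w'

/-- `PureCoStrategy X Y r w`: the `r`-round pure co-strategies (`r ≥ 1`) that are compatible with the
strategies in `PureStrategy X Y r _` and have final memory space `ℂ^w`. The last isometry has no
outgoing message, that is, its message space is `ℂ`. -/
inductive PureCoStrategy : ℕ → ℕ → Type _
  | final {k w w' : ℕ} (P : PureCoPrefix X Y k w)
      (B : Matrix (Fin w') (Y k × Fin w) ℂ) (isometry : Bᴴ * B = 1) :
      PureCoStrategy (k + 1) w'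

end Strategies

section Interaction

variable {X Y : ℕ → Type*} [∀ i, Fintype (X i)] [∀ i, DecidableEq (X i)]
  [∀ i, Fintype (Y i)] [∀ i, DecidableEq (Y i)]

/-- The single isometry from `X 0 ⊗ ⋯ ⊗ X (r - 1)` to `(Y 0 ⊗ ⋯ ⊗ Y (r - 1)) ⊗ ℂ^z` that represents a
pure strategy, obtained by composing its isometries along the memory. -/
noncomputable def PureStrategy.toMatrix :
    {r z : ℕ} → PureStrategy X Y r z → Matrix (Hist Y r × Fin z) (Hist X r) ℂ
  | _, _, .nil => Matrix.of fun _ _ => 1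
  | r + 1, _, .snoc P A _ => Matrix.of fun p x =>
      ∑ m, A (p.1 (Fin.last r), p.2) (x (Fin.last r), m) *
        P.toMatrix (fun i => p.1 i.castSucc, m) (fun i => x i.castSucc)

/-- The channel `ρ ↦ Tr_Z (Ã ρ Ã*)` of the strategy obtained from the pure strategy `Ã`. -/
noncomputable def PureStrategy.channel {r z : ℕ} (P : PureStrategy X Y r z)
    (ρ : Matrix (Hist X r) (Hist X r) ℂ) : Matrix (Hist Y r) (Hist Y r) ℂ :=
  trSecond (P.toMatrix * ρ * P.toMatrixᴴ)

/-- The pure strategy `P` is a purification of the strategy `S`, where strategies are identified with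
the Choi-Jamiolkowski representations of their channels. -/
def PureStrategy.IsPurification {r z : ℕ} (P : PureStrategy X Y r z)
    (S : Matrix (Hist Y r × Hist X r) (Hist Y r × Hist X r) ℂ) : Prop :=
  choi P.channel = S

/-- The vectorization `|Ã⟩⟩ ∈ Z ⊗ (Y 0 ⊗ ⋯ ⊗ Y (r - 1)) ⊗ (X 0 ⊗ ⋯ ⊗ X (r - 1))` of a pure strategy. -/
noncomputable def PureStrategy.vec {r z : ℕ} (P : PureStrategy X Y r z) :
    Fin z × (Hist Y r × Hist X r) → ℂ :=
  fun p => P.toMatrix (p.2.1, p.1) p.2.2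

/-- The vector `(A ⊗ I) φ`, for an isometry `A` of a strategy and a vector `φ` in
(memory of the strategy) ⊗ (message) ⊗ (memory of the co-strategy). -/
def applyLeft {a b ι κ μ : Type*} [Fintype a] [Fintype ι]
    (A : Matrix (b × κ) (a × ι) ℂ) (φ : ι × a × μ → ℂ) : κ × b × μ → ℂ :=
  fun p => ∑ q : a × ι, A (p.2.1, p.1) q * φ (q.2, q.1, p.2.2)

/-- The vector `(I ⊗ B) φ`, for an isometry `B` of a co-strategy. -/
def applyRight {b ι μ τ : Type*} [Fintype b] [Fintype μ]
    (B : Matrix τ (b × μ) ℂ) (φ : ι × b × μ → ℂ) : ι × τ → ℂ :=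
  fun p => ∑ q : b × μ, B p.2 q * φ (p.1, q.1, q.2)

/-- The joint state in (memory of the strategy) ⊗ (message `X k`) ⊗ (memory of the co-strategy) after
`k` rounds of interaction. -/
noncomputable def jointState :
    {k z w : ℕ} → PureStrategy X Y k z → PureCoPrefix X Y k w → Fin z × X k × Fin w → ℂ
  | _, _, _, .nil, .start β _ => fun p => β p.2
  | _, _, _, .snoc P A _, .snoc Q B _ => applyRight B (applyLeft A (jointState P Q))

/-- The final state `|ψ(Ã, B̃)⟩ ∈ Z ⊗ W` of the interaction. -/
noncomputable def finalState :
    {r z w : ℕ} → PureStrategy X Y r z → PureCoStrategy X Y r w → Fin z × Fin w → ℂ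
  | _, _, _, .snoc P A _, .final Q B _ => applyRight B (applyLeft A (jointState P Q))

/-- The reduced state `Tr_Z |ψ(Ã, B̃)⟩⟨ψ(Ã, B̃)|` of the final memory space of the co-strategy. -/
noncomputable def reducedState {r z w : ℕ} (P : PureStrategy X Y r z) (B : PureCoStrategy X Y r w) :
    Matrix (Fin w) (Fin w) ℂ :=
  trFirst (Matrix.vecMulVec (finalState P B) (star (finalState P B)))

/-- The fidelities of the final reduced states that arise from the strategies `S` and `T` when each of
them interacts with the same pure co-strategy. The reduced state is the same for all purifications of
a strategy. -/
def fidelityValues {r : ℕ} (S T : Matrix (Hist Y r × Hist X r) (Hist Y r × Hist X r) ℂ) : Set ℝ :=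
  {f | ∃ (w : ℕ) (B : PureCoStrategy X Y r w) (z z' : ℕ) (P : PureStrategy X Y r z)
      (Q : PureStrategy X Y r z'), P.IsPurification S ∧ Q.IsPurification T ∧
        f = fidelity (reducedState P B) (reducedState Q B)}

/-- The strategy fidelity `F_r(S, T)`. -/
noncomputable def strategyFidelity {r : ℕ}
    (S T : Matrix (Hist Y r × Hist X r) (Hist Y r × Hist X r) ℂ) : ℝ :=
  sInf (fidelityValues S T)

/-! ## The semidefinite program -/

/-- The partial trace over the last output space `Y j`. -/
def trLastOutput {j k : ℕ} (R : Matrix (Hist Y (j + 1) × Hist X k) (Hist Y (j + 1) × Hist X k) ℂ) :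
    Matrix (Hist Y j × Hist X k) (Hist Y j × Hist X k) ℂ :=
  Matrix.of fun p q => ∑ b : Y j,
    R (Fin.snoc (α := fun i => Y i) p.1 b, p.2) (Fin.snoc (α := fun i => Y i) q.1 b, q.2)

/-- The tensor product `R ⊗ I` with the identity of the next input space `X j`. -/
def tensorNextInput {j : ℕ} (R : Matrix (Hist Y j × Hist X j) (Hist Y j × Hist X j) ℂ) :
    Matrix (Hist Y j × Hist X (j + 1)) (Hist Y j × Hist X (j + 1)) ℂ :=
  Matrix.of fun p q =>
    R (p.1, fun i => p.2 i.castSucc) (q.1, fun i => q.2 i.castSucc) *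
      (1 : Matrix (X j) (X j) ℂ) (p.2 (Fin.last j)) (q.2 (Fin.last j))

/-- The operator `½ Tr_Z ((K ⊗ I) |T̃⟩⟩⟨⟨S̃|) + h.c.` -/
noncomputable def overlapOperator {r z : ℕ} (P Q : PureStrategy X Y r z)
    (K : Matrix (Fin z) (Fin z) ℂ) : Matrix (Hist Y r × Hist X r) (Hist Y r × Hist X r) ℂ :=
  let M := trFirst ((K ⊗ₖ (1 : Matrix (Hist Y r × Hist X r) (Hist Y r × Hist X r) ℂ)) *
    Matrix.vecMulVec Q.vec (star P.vec))
  (1 / 2 : ℂ) • M + ((1 / 2 : ℂ) • M)ᴴ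

/-- `(t, R 1, …, R r, K)` is a feasible point of the semidefinite program for the pure strategies `P`
(which purifies `S`) and `Q` (which purifies `T`). The values `R j` for other `j` play no role. -/
structure SDPFeasible {r z : ℕ} (P Q : PureStrategy X Y r z) (t : ℝ)
    (R : (j : ℕ) → Matrix (Hist Y j × Hist X j) (Hist Y j × Hist X j) ℂ)
    (K : Matrix (Fin z) (Fin z) ℂ) : Prop where
  hermitian : ∀ j, 1 ≤ j → j ≤ r → (R j).IsHermitian
  first : (t : ℂ) • (1 : Matrix (Hist Y 0 × Hist X 1) (Hist Y 0 × Hist X 1) ℂ) ≤ trLastOutput (R 1)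
  step : ∀ j, 1 ≤ j → j < r → tensorNextInput (R j) ≤ trLastOutput (R (j + 1))
  last : R r ≤ overlapOperator P Q K
  block : (Matrix.fromBlocks 1 K Kᴴ 1).PosSemidef

/-- The objective function values of the feasible points of the semidefinite program. -/
def sdpValues {r z : ℕ} (P Q : PureStrategy X Y r z) : Set ℝ :=
  {t | ∃ (R : (j : ℕ) → Matrix (Hist Y j × Hist X j) (Hist Y j × Hist X j) ℂ)
      (K : Matrix (Fin z) (Fin z) ℂ), SDPFeasible P Q t R K}

end Interaction

/-! A co-strategy matters only through one positive operator. Contracting its isometries along the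
memory gives a matrix C (`coMatrix`) from histories to the final memory, and the final state against
a pure strategy is C V, where V is the vectorized strategy read as a matrix. The reduced states are
(C V_S)(C V_S)* and (C V_T)(C V_T)*, so their fidelity is the trace norm of (C V_S)* C V_T.
Trace-norm duality makes this the maximum over contractions K of Re Tr(C* C · overlap(K)), which
involves only C* C.

The Gram operators N_0, …, N_{r-1} of the prefixes of a co-strategy form a chain: Tr N_0 = 1, Tr_X
N_{j+1} = N_j ⊗ I_Y, and C* C = N_{r-1} ⊗ I_Y. Conversely every positive semidefinite chain arises
(`exists_pureCoStrategy_gram`), because matrices with equal Gram matrices differ by an isometry. The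
strategy fidelity is thus a minimum over chains of a maximum over K of a bilinear form, with the R_j
as multipliers for the chain conditions.

Weak duality telescopes the constraints along the chain (`SDPFeasible.le_fidelity`). For strong
duality, let v be the optimal value, attained by compactness. Fix R_0 = v and R_r = overlap(K), and
let K run over contractions and the other R_j over Hermitian operators. The resulting slack tuples
form a convex set that misses the positive definite tuples, since otherwise v could be increased. A
separating functional is a positive semidefinite tuple N. Freedom of the intermediate R_j forces the
chain conditions, and strictness of the separation forces Tr N_0 > 0. Since K already varies inside
the separated set, the normalized chain bounds the pairing by v for all K at once, with no separate
minimax theorem; a co-strategy realizing it has fidelity v. -/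

set_option linter.unusedSectionVars false

/-! ### Contractions, trace norm, fidelity, and isometries from equal Gram matrices -/

section MatrixAnalysis

variable {ι κ m n p : Type*} [Fintype ι] [DecidableEq ι] [Fintype κ] [DecidableEq κ]
  [Fintype m] [DecidableEq m] [Fintype n] [DecidableEq n] [Fintype p]

/-- A Hermitian matrix has a Hermitian pseudoinverse that commutes with it. -/
theorem Matrix.IsHermitian.exists_pseudoinverse {P : Matrix n n ℂ} (hP : P.IsHermitian) :
    ∃ J : Matrix n n ℂ, Jᴴ = J ∧ P * J = J * P ∧ P * J * P = P ∧ J * P * J = J := by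
  have hsa : IsSelfAdjoint P := hP
  have hc : ∀ f : ℝ → ℝ, ContinuousOn f (spectrum ℝ P) := fun f =>
    (Matrix.finite_real_spectrum (A := P)).continuousOn f
  have hid : P = cfc (fun x : ℝ => x) P := (cfc_id' ℝ P).symm
  -- The convention 0⁻¹ = 0 makes functional calculus with x⁻¹ the pseudoinverse.
  refine ⟨cfc (fun x : ℝ => x⁻¹) P, ?_, ?_, ?_, ?_⟩
  · exact (IsSelfAdjoint.cfc (f := fun x : ℝ => x⁻¹) (a := P))
  · have h1 := (cfc_commute_cfc (fun x : ℝ => x) (fun x : ℝ => x⁻¹) P).eq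
    rwa [← hid] at h1
  · have h1 : cfc (fun x : ℝ => x) P * cfc (fun x : ℝ => x⁻¹) P * cfc (fun x : ℝ => x) P
        = cfc (fun x : ℝ => x) P := by
      rw [← cfc_mul _ _ P (hc _) (hc _), ← cfc_mul _ _ P (hc _) (hc _)]
      congr 1; ext x; exact mul_inv_mul_cancel x
    rwa [← hid] at h1
  · have h1 : cfc (fun x : ℝ => x⁻¹) P * cfc (fun x : ℝ => x) P * cfc (fun x : ℝ => x⁻¹) P
        = cfc (fun x : ℝ => x⁻¹) P := by
      rw [← cfc_mul _ _ P (hc _) (hc _), ← cfc_mul _ _ P (hc _) (hc _)]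
      congr 1; ext x
      simpa using mul_inv_mul_cancel x⁻¹
    rwa [← hid] at h1

/-- A matrix vanishes on the kernel of its Gram matrix. -/
theorem Matrix.mul_eq_self_of_conjTranspose_mul_self {A : Matrix m n ℂ} {G Q : Matrix n n ℂ}
    (hA : Aᴴ * A = G) (hG : G * Q = G) : A * Q = A := by
  have : A * (1 - Q) = 0 := by
    rw [← Matrix.conjTranspose_mul_self_eq_zero, Matrix.conjTranspose_mul]
    calc (1 - Q)ᴴ * Aᴴ * (A * (1 - Q)) = (1 - Q)ᴴ * ((Aᴴ * A) * (1 - Q)) := by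
          simp only [Matrix.mul_assoc]
      _ = 0 := by rw [hA, Matrix.mul_sub, hG]; simp
  rw [Matrix.mul_sub, Matrix.mul_one, sub_eq_zero] at this
  exact this.symm

/-- A contraction, in the form of the block constraint of the semidefinite program. -/
theorem posSemidef_fromBlocks_one_iff {K : Matrix m n ℂ} :
    (Matrix.fromBlocks 1 K Kᴴ 1).PosSemidef ↔ (1 - Kᴴ * K).PosSemidef := by
  have : Invertible (1 : Matrix m m ℂ) := invertibleOne
  have := Matrix.PosDef.fromBlocks₁₁ (A := (1 : Matrix m m ℂ)) K (1 : Matrix n n ℂ)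
    Matrix.PosDef.one
  simpa using this

theorem posSemidef_fromBlocks_one_iff' {K : Matrix m n ℂ} :
    (Matrix.fromBlocks 1 K Kᴴ 1).PosSemidef ↔ (1 - K * Kᴴ).PosSemidef := by
  have : Invertible (1 : Matrix n n ℂ) := invertibleOne
  have := Matrix.PosDef.fromBlocks₂₂ (1 : Matrix m m ℂ) K (D := (1 : Matrix n n ℂ))
    Matrix.PosDef.one
  simpa using this

theorem posSemidef_one_sub_conjTranspose {K : Matrix m n ℂ} (hK : (1 - Kᴴ * K).PosSemidef) :
    (1 - Kᴴᴴ * Kᴴ).PosSemidef := by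
  rw [Matrix.conjTranspose_conjTranspose]
  exact posSemidef_fromBlocks_one_iff'.1 (posSemidef_fromBlocks_one_iff.2 hK)

theorem posSemidef_one_sub_transpose {K : Matrix m n ℂ} (hK : (1 - Kᴴ * K).PosSemidef) :
    (1 - Kᵀᴴ * Kᵀ).PosSemidef := by
  have := (posSemidef_one_sub_conjTranspose hK).transpose
  rw [Matrix.conjTranspose_conjTranspose, Matrix.transpose_sub, Matrix.transpose_mul,
    Matrix.transpose_one] at this
  exact this

/-- The trace norm `Tr √(A* A)` of a rectangular matrix. -/
noncomputable def rectTraceNorm (A : Matrix m n ℂ) : ℝ := (CFC.sqrt (Aᴴ * A)).trace.re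

theorem sqrt_gram (A : Matrix m n ℂ) :
    (CFC.sqrt (Aᴴ * A)).PosSemidef ∧ CFC.sqrt (Aᴴ * A) * CFC.sqrt (Aᴴ * A) = Aᴴ * A := by
  have h : 0 ≤ Aᴴ * A := (Matrix.posSemidef_conjTranspose_mul_self A).nonneg
  exact ⟨Matrix.nonneg_iff_posSemidef.1 (CFC.sqrt_nonneg _), CFC.sqrt_mul_sqrt_self _ h⟩

/-- The trace norm is attained by a contraction. -/
theorem exists_contraction_rectTraceNorm (A : Matrix m n ℂ) :
    ∃ K : Matrix n m ℂ, (1 - Kᴴ * K).PosSemidef ∧ (K * A).trace.re = rectTraceNorm A := by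
  obtain ⟨hP, hPP⟩ := sqrt_gram A
  obtain ⟨J, hJ, hc, hPJP, hJPJ⟩ := hP.1.exists_pseudoinverse
  unfold rectTraceNorm
  set P := CFC.sqrt (Aᴴ * A)
  -- In the polar decomposition A = (A J) P the partial isometry is A J; its adjoint attains the
  -- norm.
  refine ⟨J * Aᴴ, ?_, ?_⟩
  · rw [← posSemidef_fromBlocks_one_iff, posSemidef_fromBlocks_one_iff']
    have h1 : J * Aᴴ * (J * Aᴴ)ᴴ = J * P := by
      rw [Matrix.conjTranspose_mul, Matrix.conjTranspose_conjTranspose, hJ]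
      calc J * Aᴴ * (A * J) = J * (Aᴴ * A) * J := by simp only [Matrix.mul_assoc]
        _ = J * P * (P * J) := by rw [← hPP]; simp only [Matrix.mul_assoc]
        _ = J * P * J * P := by rw [hc]; simp only [Matrix.mul_assoc]
        _ = J * P := by rw [hJPJ]
    have h2 : (1 - J * P) = (1 - J * P)ᴴ * (1 - J * P) := by
      rw [Matrix.conjTranspose_sub, Matrix.conjTranspose_mul, hJ, hP.1, hc,
        Matrix.conjTranspose_one]
      simp only [Matrix.mul_sub, Matrix.sub_mul, Matrix.one_mul, Matrix.mul_one]
      rw [← Matrix.mul_assoc, hJPJ]; simp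
    rw [h1, h2]
    exact Matrix.posSemidef_conjTranspose_mul_self _
  · rw [Matrix.mul_assoc, ← hPP, ← Matrix.mul_assoc, ← hc, hPJP]

/-- The trace norm is an upper bound for the pairing with contractions. -/
theorem re_trace_mul_le_rectTraceNorm (A : Matrix m n ℂ) {K : Matrix n m ℂ}
    (hK : (1 - Kᴴ * K).PosSemidef) : (K * A).trace.re ≤ rectTraceNorm A := by
  obtain ⟨hP, hPP⟩ := sqrt_gram A
  obtain ⟨J, hJ, hc, hPJP, hJPJ⟩ := hP.1.exists_pseudoinverse
  unfold rectTraceNorm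
  set P := CFC.sqrt (Aᴴ * A)
  have hA : A * (J * P) = A := Matrix.mul_eq_self_of_conjTranspose_mul_self rfl (by
    rw [← hPP, Matrix.mul_assoc, ← Matrix.mul_assoc P J P, hPJP])
  have hSS : CFC.sqrt P * CFC.sqrt P = P := CFC.sqrt_mul_sqrt_self _ hP.nonneg
  have hS : (CFC.sqrt P)ᴴ = CFC.sqrt P :=
    (Matrix.nonneg_iff_posSemidef.1 (CFC.sqrt_nonneg P)).1
  set S := CFC.sqrt P
  have hWtr : ((A * J * S)ᴴ * (A * J * S)).trace = P.trace := by
    have : (A * J * S)ᴴ * (A * J * S) = S * (J * (P * P * J * S)) := by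
      simp only [Matrix.conjTranspose_mul, hJ, hS, hPP, Matrix.mul_assoc]
    rw [this, Matrix.trace_mul_comm]
    congr 1
    calc J * (P * P * J * S) * S = J * P * (P * J) * (S * S) := by
          simp only [Matrix.mul_assoc]
      _ = J * P * J * P * P := by rw [hSS, hc]; simp only [Matrix.mul_assoc]
      _ = P := by rw [hJPJ, ← hc, hPJP]
  -- With A J the polar partial isometry, W carries the factor S = √P, so that Tr(K A) is the
  -- Hilbert–Schmidt pairing of S with K W. The bound is Cauchy–Schwarz: expand ‖S - K W‖² ≥ 0 and
  -- use ‖K W‖² ≤ ‖W‖² = Tr P = ‖S‖².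
  set W := A * J * S
  have hcross : (Sᴴ * (K * W)).trace = (K * A).trace := by
    rw [hS, Matrix.trace_mul_comm]
    calc (K * (A * J * S) * S).trace = (K * (A * (J * (S * S)))).trace := by
          simp only [Matrix.mul_assoc]
      _ = (K * A).trace := by rw [hSS, hA]
  have h1 : 0 ≤ ((S - K * W)ᴴ * (S - K * W)).trace.re :=
    (Complex.le_def.1 (Matrix.posSemidef_conjTranspose_mul_self (S - K * W)).trace_nonneg).1
  have h2 : 0 ≤ (Wᴴ * (1 - Kᴴ * K) * W).trace.re :=
    (Complex.le_def.1 (hK.conjTranspose_mul_mul_same W).trace_nonneg).1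
  have h3 : ((K * W)ᴴ * S).trace.re = (K * A).trace.re := by
    rw [← hcross, ← Matrix.conjTranspose_conjTranspose S, ← Matrix.conjTranspose_mul,
      Matrix.trace_conjTranspose]
    simp [hS]
  have h4 : (Wᴴ * (1 - Kᴴ * K) * W).trace = P.trace - ((K * W)ᴴ * (K * W)).trace := by
    rw [← hWtr, ← Matrix.trace_sub]
    congr 1
    simp only [Matrix.mul_sub, Matrix.sub_mul, Matrix.mul_one, Matrix.conjTranspose_mul,
      Matrix.mul_assoc]
  have h5 : ((S - K * W)ᴴ * (S - K * W)).trace = P.trace - (Sᴴ * (K * W)).trace -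
      (((K * W)ᴴ * S).trace - ((K * W)ᴴ * (K * W)).trace) := by
    rw [Matrix.conjTranspose_sub, Matrix.sub_mul, Matrix.mul_sub, Matrix.mul_sub,
      Matrix.trace_sub, Matrix.trace_sub, Matrix.trace_sub, show Sᴴ * S = P by rw [hS, hSS]]
  rw [h4, Complex.sub_re] at h2
  rw [h5, hcross] at h1
  simp only [Complex.sub_re, h3] at h1
  linarith

/-- An optimal contraction K for A gives the contraction K* for A*, with the same real pairing. -/
theorem rectTraceNorm_conjTranspose_le (A : Matrix m n ℂ) :
    rectTraceNorm A ≤ rectTraceNorm Aᴴ := by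
  obtain ⟨K, hK, h⟩ := exists_contraction_rectTraceNorm A
  rw [← h]
  refine le_trans (le_of_eq ?_)
    (re_trace_mul_le_rectTraceNorm Aᴴ (posSemidef_one_sub_conjTranspose hK))
  rw [← Matrix.conjTranspose_mul, Matrix.trace_conjTranspose, Matrix.trace_mul_comm]
  simp

theorem rectTraceNorm_conjTranspose (A : Matrix m n ℂ) :
    rectTraceNorm Aᴴ = rectTraceNorm A :=
  le_antisymm (by simpa using rectTraceNorm_conjTranspose_le Aᴴ)
    (rectTraceNorm_conjTranspose_le A)

/-- The fidelity of `M M*` and `L L*` is the trace norm of `M* L`. -/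
theorem fidelity_mul_conjTranspose (M L : Matrix m n ℂ) :
    fidelity (M * Mᴴ) (L * Lᴴ) = rectTraceNorm (Mᴴ * L) := by
  have hs : ∀ B : Matrix m n ℂ, (CFC.sqrt (B * Bᴴ))ᴴ = CFC.sqrt (B * Bᴴ) ∧
      CFC.sqrt (B * Bᴴ) * CFC.sqrt (B * Bᴴ) = B * Bᴴ := fun B => by
    simpa [Matrix.conjTranspose_conjTranspose] using
      And.intro (sqrt_gram Bᴴ).1.1.eq (sqrt_gram Bᴴ).2
  obtain ⟨hM, hMM⟩ := hs M
  obtain ⟨hL, hLL⟩ := hs L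
  unfold fidelity traceNorm
  set P := CFC.sqrt (M * Mᴴ)
  set Q := CFC.sqrt (L * Lᴴ)
  -- The trace norm depends only on the Gram matrix, which replaces the left root by M*; passing to
  -- the adjoint replaces the right root by L in the same way.
  calc (CFC.sqrt ((P * Q)ᴴ * (P * Q))).trace.re = rectTraceNorm (Mᴴ * Q) := by
        unfold rectTraceNorm
        congr 3
        calc (P * Q)ᴴ * (P * Q) = Q * (P * P) * Q := by
              simp only [Matrix.conjTranspose_mul, hM, hL, Matrix.mul_assoc]
          _ = _ := by
              rw [hMM]
              simp only [Matrix.conjTranspose_mul, Matrix.conjTranspose_conjTranspose, hL,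
                Matrix.mul_assoc]
    _ = rectTraceNorm (Mᴴ * Q)ᴴ := (rectTraceNorm_conjTranspose _).symm
    _ = rectTraceNorm (Mᴴ * L)ᴴ := by
        unfold rectTraceNorm
        congr 3
        calc (Mᴴ * Q)ᴴᴴ * (Mᴴ * Q)ᴴ = Mᴴ * (Q * Q) * M := by
              simp only [Matrix.conjTranspose_mul, Matrix.conjTranspose_conjTranspose, hL,
                Matrix.mul_assoc]
          _ = _ := by
              rw [hLL]
              simp only [Matrix.conjTranspose_mul, Matrix.conjTranspose_conjTranspose,
                Matrix.mul_assoc]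
    _ = rectTraceNorm (Mᴴ * L) := rectTraceNorm_conjTranspose _

/-- Two matrices with the same Gram matrix are related by an isometry, after enlarging the target
space. -/
theorem exists_isometry_of_gram_eq (E : Matrix ι p ℂ) (D : Matrix κ p ℂ)
    (h : Eᴴ * E = Dᴴ * D) :
    ∃ (V : Matrix κ ι ℂ) (Q : Matrix ι ι ℂ), Vᴴ * V + Qᴴ * Q = 1 ∧ V * E = D ∧ Q * E = 0 := by
  classical
  obtain ⟨J, hJ, hc, hGJG, hJGJ⟩ :=
    (Matrix.isHermitian_conjTranspose_mul_self E).exists_pseudoinverse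
  set G := Eᴴ * E with hG
  have hGQ : G * (J * G) = G := by rw [← Matrix.mul_assoc, hGJG]
  have hE : E * (J * G) = E := Matrix.mul_eq_self_of_conjTranspose_mul_self hG.symm hGQ
  have hD : D * (J * G) = D := Matrix.mul_eq_self_of_conjTranspose_mul_self h.symm hGQ
  have hV : (D * J * Eᴴ)ᴴ * (D * J * Eᴴ) = E * J * Eᴴ := by
    calc (D * J * Eᴴ)ᴴ * (D * J * Eᴴ) = E * (J * (Dᴴ * D) * J) * Eᴴ := by
          simp only [Matrix.conjTranspose_mul, Matrix.conjTranspose_conjTranspose, hJ,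
            Matrix.mul_assoc]
      _ = _ := by rw [← h, hJGJ]
  have hQ : E * J * Eᴴ * (E * J * Eᴴ) = E * J * Eᴴ := by
    calc E * J * Eᴴ * (E * J * Eᴴ) = E * (J * (Eᴴ * E) * J) * Eᴴ := by
          simp only [Matrix.mul_assoc]
      _ = _ := by rw [← hG, hJGJ]
  -- E J E* is the projection onto the range of E. The first matrix is the partial isometry taking E
  -- to D, and the second is the complementary projection; stacked, they form an isometry.
  refine ⟨D * J * Eᴴ, 1 - E * J * Eᴴ, ?_, ?_, ?_⟩
  · have hQs : (1 - E * J * Eᴴ)ᴴ = 1 - E * J * Eᴴ := by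
      simp only [Matrix.conjTranspose_sub, Matrix.conjTranspose_mul, Matrix.conjTranspose_one,
        Matrix.conjTranspose_conjTranspose, hJ, Matrix.mul_assoc]
    rw [hV, hQs, Matrix.sub_mul, Matrix.mul_sub, Matrix.one_mul, Matrix.mul_sub, hQ]
    simp
  · rw [Matrix.mul_assoc, Matrix.mul_assoc, ← hG, hD]
  · rw [Matrix.sub_mul, Matrix.one_mul, Matrix.mul_assoc, Matrix.mul_assoc, ← hG, hE, sub_self]

end MatrixAnalysis

/-! ### Interaction as a contraction of two tensors -/

section CoStrategyOperators

variable {X Y : ℕ → Type*} [∀ i, Fintype (X i)] [∀ i, DecidableEq (X i)]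
  [∀ i, Fintype (Y i)] [∀ i, DecidableEq (Y i)]

/-- A sum over histories of length `k + 1` splits off the last entry. -/
theorem sum_hist_succ {M : Type*} {X : ℕ → Type*} [∀ i, Fintype (X i)] [AddCommMonoid M]
    (k : ℕ)
    (f : Hist X (k + 1) → M) :
    ∑ x, f x = ∑ x : Hist X k, ∑ a : X k, f (Fin.snoc (α := fun i => X i) x a) := by
  rw [Finset.sum_comm, ← Fintype.sum_prod_type']
  exact (Equiv.sum_comp (Fin.snocEquiv fun i : Fin (k + 1) => X i) f).symm

/-- Composing one round produces sums over the two memories, the last input and the past histories;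
this moves the histories to the front. -/
theorem sum_rotate {α β γ δ ε M : Type*} [Fintype α] [Fintype β] [Fintype γ] [Fintype δ]
    [Fintype ε] [AddCommMonoid M] (f : α → β → γ → δ → ε → M) :
    ∑ a, ∑ b, ∑ c, ∑ d, ∑ e, f a b c d e = ∑ d, ∑ e, ∑ b, ∑ c, ∑ a, f a b c d e := by
  have h := Equiv.sum_comp
    (⟨fun t => (t.2.2.2.2, t.2.2.1, t.2.2.2.1, t.1, t.2.1),
      fun t => (t.2.2.2.1, t.2.2.2.2, t.2.1, t.2.2.1, t.1), fun _ => rfl, fun _ => rfl⟩ :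
      δ × ε × β × γ × α ≃ α × β × γ × δ × ε)
    (fun t => f t.1 t.2.1 t.2.2.1 t.2.2.2.1 t.2.2.2.2)
  simp only [Fintype.sum_prod_type] at h
  exact h.symm

/-- The partial trace over the last input space. -/
def trLastInput {j k : ℕ} (N : Matrix (Hist Y j × Hist X (k + 1)) (Hist Y j × Hist X (k + 1)) ℂ) :
    Matrix (Hist Y j × Hist X k) (Hist Y j × Hist X k) ℂ :=
  Matrix.of fun p q => ∑ a : X k,
    N (p.1, Fin.snoc (α := fun i => X i) p.2 a) (q.1, Fin.snoc (α := fun i => X i) q.2 a)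

/-- The tensor product `N ⊗ I` with the identity of the next output space. -/
def tensorNextOutput {j k : ℕ} (N : Matrix (Hist Y j × Hist X k) (Hist Y j × Hist X k) ℂ) :
    Matrix (Hist Y (j + 1) × Hist X k) (Hist Y (j + 1) × Hist X k) ℂ :=
  Matrix.of fun p q => N (Fin.init p.1, p.2) (Fin.init q.1, q.2) *
    (1 : Matrix (Y j) (Y j) ℂ) (p.1 (Fin.last j)) (q.1 (Fin.last j))

/-- Tensoring with an identity is adjoint to the partial trace. This and its input analogue
`trace_trLastInput_mul` drive the telescoping in both duality arguments. -/
theorem trace_tensorNextOutput_mul {j k : ℕ}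
    (N : Matrix (Hist Y j × Hist X k) (Hist Y j × Hist X k) ℂ)
    (R : Matrix (Hist Y (j + 1) × Hist X k) (Hist Y (j + 1) × Hist X k) ℂ) :
    (tensorNextOutput N * R).trace = (N * trLastOutput R).trace := by
  simp only [Matrix.trace, Matrix.diag_apply, Matrix.mul_apply, Fintype.sum_prod_type,
    sum_hist_succ (X := Y), tensorNextOutput, trLastOutput, Matrix.of_apply, Fin.init_snoc,
    Fin.snoc_last, Matrix.one_apply, mul_ite, mul_one, mul_zero, ite_mul, zero_mul,
    Finset.mul_sum]
  refine Finset.sum_congr rfl fun y _ => ?_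
  rw [Finset.sum_comm]
  refine Finset.sum_congr rfl fun x _ => ?_
  rw [Finset.sum_comm]
  refine Finset.sum_congr rfl fun y' _ => ?_
  rw [Finset.sum_comm' (t' := Finset.univ) (s' := fun _ => Finset.univ) (by simp)]
  conv_rhs => rw [Finset.sum_comm]
  refine Finset.sum_congr rfl fun b _ => ?_
  simp

theorem trace_trLastInput_mul {j : ℕ}
    (N : Matrix (Hist Y j × Hist X (j + 1)) (Hist Y j × Hist X (j + 1)) ℂ)
    (R : Matrix (Hist Y j × Hist X j) (Hist Y j × Hist X j) ℂ) :
    (trLastInput N * R).trace = (N * tensorNextInput R).trace := by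
  simp only [Matrix.trace, Matrix.diag_apply, Matrix.mul_apply, Fintype.sum_prod_type,
    sum_hist_succ (X := X), tensorNextInput, trLastInput, Matrix.of_apply, Fin.snoc_castSucc,
    Fin.snoc_last, Matrix.one_apply, mul_ite, mul_one, mul_zero, Finset.sum_mul]
  refine Finset.sum_congr rfl fun y _ => ?_
  refine Finset.sum_congr rfl fun x _ => ?_
  rw [Finset.sum_comm' (t' := Finset.univ) (s' := fun _ => Finset.univ) (by simp)]
  simp only [Finset.sum_ite_eq', Finset.mem_univ, if_true]
  conv_rhs => rw [Finset.sum_comm]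
  conv_lhs => rw [Finset.sum_comm]
  refine Finset.sum_congr rfl fun y' _ => ?_
  rw [Finset.sum_comm]

/-- The matrix of the linear map from histories to the memory of a co-strategy prefix. -/
noncomputable def PureCoPrefix.coMatrix :
    {k w : ℕ} → PureCoPrefix X Y k w → Matrix (Fin w) (Hist Y k × Hist X (k + 1)) ℂ
  | _, _, .start β _ => Matrix.of fun m q => β (q.2 (Fin.last 0), m)
  | k + 1, _, .snoc Q B _ => Matrix.of fun m' q =>
      ∑ m, B (q.2 (Fin.last (k + 1)), m') (q.1 (Fin.last k), m) *
        Q.coMatrix m (Fin.init q.1, Fin.init q.2)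

/-- The matrix of the linear map from histories to the final memory of a co-strategy. -/
noncomputable def PureCoStrategy.coMatrix :
    {r w : ℕ} → PureCoStrategy X Y r w → Matrix (Fin w) (Hist Y r × Hist X r) ℂ
  | k + 1, _, .final Q B _ => Matrix.of fun m' q =>
      ∑ m, B m' (q.1 (Fin.last k), m) * Q.coMatrix m (Fin.init q.1, q.2)

/-- The two parties share only the messages, so the state is a tensor of the co-strategy alone
contracted over histories with a tensor of the strategy alone. Each round of the induction is a
reordering of finite sums. -/
theorem jointState_eq {k z w : ℕ} (P : PureStrategy X Y k z) (Q : PureCoPrefix X Y k w)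
    (m : Fin z) (x : X k) (l : Fin w) :
    jointState P Q (m, x, l) =
      ∑ q, Q.coMatrix l (q.1, Fin.snoc (α := fun i => X i) q.2 x) * P.vec (m, q) := by
  induction Q generalizing z with
  | start β hβ =>
    cases P
    have : ∀ q : Hist Y 0 × Hist X 0,
        Fin.snoc (α := fun i : Fin 1 => X i) q.2 x (Fin.last 0) = x := fun q => Fin.snoc_last _ _
    simp only [jointState, PureCoPrefix.coMatrix, PureStrategy.vec, PureStrategy.toMatrix,
      Matrix.of_apply, mul_one]
    rw [Fintype.sum_subsingleton _ (default, default)]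
    exact congrArg (fun a => β (a, l)) (this _).symm
  | snoc Q B hB ih =>
    cases P with
    | snoc P A hA =>
    simp only [jointState, applyRight, applyLeft, ih, PureCoPrefix.coMatrix, PureStrategy.vec,
      PureStrategy.toMatrix, Fintype.sum_prod_type, sum_hist_succ, Matrix.of_apply, Fin.init_snoc,
      Fin.snoc_last, Fin.snoc_castSucc, Finset.mul_sum, Finset.sum_mul]
    conv_rhs => rw [Finset.sum_comm]
    refine Finset.sum_congr rfl fun b _ => ?_
    rw [sum_rotate]
    exact Finset.sum_congr rfl fun y _ => Finset.sum_congr rfl fun x' _ =>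
      Finset.sum_congr rfl fun a _ => Finset.sum_congr rfl fun m' _ =>
      Finset.sum_congr rfl fun l' _ => by ring

theorem finalState_eq {r z w : ℕ} (P : PureStrategy X Y r z) (B : PureCoStrategy X Y r w)
    (m : Fin z) (l : Fin w) :
    finalState P B (m, l) = ∑ q, B.coMatrix l q * P.vec (m, q) := by
  cases B with
  | final Q B hB =>
    cases P with
    | snoc P A hA =>
    simp only [finalState, applyRight, applyLeft, jointState_eq, PureCoStrategy.coMatrix,
      PureStrategy.vec, PureStrategy.toMatrix, Fintype.sum_prod_type, sum_hist_succ,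
      Matrix.of_apply, Fin.init_snoc,
      Fin.snoc_last, Fin.snoc_castSucc, Finset.mul_sum, Finset.sum_mul]
    conv_rhs => rw [Finset.sum_comm]
    refine Finset.sum_congr rfl fun b _ => ?_
    rw [sum_rotate]
    exact Finset.sum_congr rfl fun y _ => Finset.sum_congr rfl fun x' _ =>
      Finset.sum_congr rfl fun a _ => Finset.sum_congr rfl fun m' _ =>
      Finset.sum_congr rfl fun l' _ => by ring

/-! ### Fidelity of the reduced states as a pairing with a Gram operator -/

/-- A pure strategy as a matrix from the final memory space to the histories. -/
noncomputable def PureStrategy.vecMatrix {r z : ℕ} (P : PureStrategy X Y r z) :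
    Matrix (Hist Y r × Hist X r) (Fin z) ℂ := Matrix.of fun q m => P.vec (m, q)

theorem PureStrategy.choi_channel {r z : ℕ} (P : PureStrategy X Y r z) :
    choi P.channel = P.vecMatrix * P.vecMatrixᴴ := by
  ext p q
  simp only [choi, Matrix.sum_apply, Matrix.kroneckerMap_apply, PureStrategy.channel, trSecond,
    Matrix.of_apply, Matrix.mul_apply, PureStrategy.vecMatrix, PureStrategy.vec,
    Matrix.conjTranspose_apply, Matrix.single_apply]
  simp [ite_and]

/-- The reduced state is a Gram matrix of the final state, read as a matrix. -/
theorem reducedState_eq {r z w : ℕ} (P : PureStrategy X Y r z) (B : PureCoStrategy X Y r w) :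
    reducedState P B = (B.coMatrix * P.vecMatrix) * (B.coMatrix * P.vecMatrix)ᴴ := by
  ext l l'
  simp only [reducedState, trFirst, Matrix.of_apply, Matrix.vecMulVec_apply, Pi.star_apply,
    finalState_eq]
  rfl

/-- The reduced state depends only on the strategy. -/
theorem reducedState_eq_choi {r z w : ℕ} (P : PureStrategy X Y r z) (B : PureCoStrategy X Y r w) :
    reducedState P B = B.coMatrix * choi P.channel * B.coMatrixᴴ := by
  rw [reducedState_eq, P.choi_channel, Matrix.conjTranspose_mul]
  simp only [Matrix.mul_assoc]

/-- K appears transposed because the memory is the column index of `vecMatrix`. This is harmless,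
since transposition preserves contractions. -/
theorem overlapOperator_eq {r z : ℕ} (P Q : PureStrategy X Y r z)
    (K : Matrix (Fin z) (Fin z) ℂ) :
    overlapOperator P Q K = (1 / 2 : ℂ) • (Q.vecMatrix * Kᵀ * P.vecMatrixᴴ +
      (Q.vecMatrix * Kᵀ * P.vecMatrixᴴ)ᴴ) := by
  have h : trFirst ((K ⊗ₖ (1 : Matrix (Hist Y r × Hist X r) (Hist Y r × Hist X r) ℂ)) *
      Matrix.vecMulVec Q.vec (star P.vec)) = Q.vecMatrix * Kᵀ * P.vecMatrixᴴ := by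
    ext p q
    simp only [trFirst, Matrix.of_apply, Matrix.mul_apply, Matrix.kroneckerMap_apply,
      Matrix.vecMulVec_apply, Fintype.sum_prod_type, Matrix.one_apply, mul_ite, mul_one, mul_zero,
      ite_mul, zero_mul, PureStrategy.vecMatrix, Matrix.conjTranspose_apply, Pi.star_apply,
      Matrix.transpose_apply, Finset.sum_mul, Finset.sum_ite_eq, Finset.mem_univ, if_true]
    exact Finset.sum_congr rfl fun m _ => Finset.sum_congr rfl fun m' _ => by ring
  simp only [overlapOperator, h, Matrix.conjTranspose_smul, smul_add]
  simp

theorem overlapOperator_isHermitian {r z : ℕ} (P Q : PureStrategy X Y r z)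
    (K : Matrix (Fin z) (Fin z) ℂ) : (overlapOperator P Q K).IsHermitian := by
  rw [Matrix.IsHermitian, overlapOperator, Matrix.conjTranspose_add,
    Matrix.conjTranspose_conjTranspose, add_comm]

theorem re_trace_conjTranspose_mul {n : Type*} [Fintype n] {A B : Matrix n n ℂ}
    (hA : A.IsHermitian) : (A * Bᴴ).trace.re = (A * B).trace.re := by
  rw [← hA.eq, ← Matrix.conjTranspose_mul, Matrix.trace_conjTranspose, hA.eq,
    Matrix.trace_mul_comm]
  simp

/-- The overlap operator paired with the Gram matrix of a matrix `C`. -/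
theorem re_trace_gram_mul_overlapOperator {κ : Type*} [Fintype κ] {r z : ℕ}
    (P Q : PureStrategy X Y r z) (K : Matrix (Fin z) (Fin z) ℂ)
    (C : Matrix κ (Hist Y r × Hist X r) ℂ) :
    (Cᴴ * C * overlapOperator P Q K).trace.re =
      (Kᵀ * ((C * P.vecMatrix)ᴴ * (C * Q.vecMatrix))).trace.re := by
  have h := re_trace_conjTranspose_mul (B := Q.vecMatrix * Kᵀ * P.vecMatrixᴴ)
    (Matrix.isHermitian_conjTranspose_mul_self C)
  rw [overlapOperator_eq, Matrix.mul_smul, Matrix.mul_add, Matrix.trace_smul, Matrix.trace_add,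
    smul_eq_mul]
  have h2 : ((Cᴴ * C) * (Q.vecMatrix * Kᵀ * P.vecMatrixᴴ)).trace =
      (Kᵀ * ((C * P.vecMatrix)ᴴ * (C * Q.vecMatrix))).trace := by
    calc _ = ((Cᴴ * C * Q.vecMatrix) * (Kᵀ * P.vecMatrixᴴ)).trace := by
          simp only [Matrix.mul_assoc]
      _ = ((Kᵀ * P.vecMatrixᴴ) * (Cᴴ * C * Q.vecMatrix)).trace := Matrix.trace_mul_comm _ _
      _ = _ := by simp only [Matrix.conjTranspose_mul, Matrix.mul_assoc]
  rw [← h2]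
  set M := Q.vecMatrix * Kᵀ * P.vecMatrixᴴ
  have h3 : ∀ a b : ℂ, b.re = a.re → (1 / 2 * (a + b)).re = a.re := fun a b hab => by
    simp only [one_div, Complex.mul_re, Complex.inv_re, Complex.add_re, hab]
    norm_num
    ring
  exact h3 _ _ h

/-- The fidelity of the reduced states as a maximum over contractions: upper bound. -/
theorem re_trace_gram_le_fidelity {r z w : ℕ} (P Q : PureStrategy X Y r z)
    (B : PureCoStrategy X Y r w) {K : Matrix (Fin z) (Fin z) ℂ}
    (hK : (Matrix.fromBlocks 1 K Kᴴ 1).PosSemidef) :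
    (B.coMatrixᴴ * B.coMatrix * overlapOperator P Q K).trace.re ≤
      fidelity (reducedState P B) (reducedState Q B) := by
  rw [re_trace_gram_mul_overlapOperator, reducedState_eq, reducedState_eq,
    fidelity_mul_conjTranspose]
  exact re_trace_mul_le_rectTraceNorm _
    (posSemidef_one_sub_transpose (posSemidef_fromBlocks_one_iff.1 hK))

/-- The fidelity of the reduced states as a maximum over contractions: attainment. -/
theorem exists_re_trace_gram_eq_fidelity {r z w : ℕ} (P Q : PureStrategy X Y r z)
    (B : PureCoStrategy X Y r w) :
    ∃ K : Matrix (Fin z) (Fin z) ℂ, (Matrix.fromBlocks 1 K Kᴴ 1).PosSemidef ∧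
      (B.coMatrixᴴ * B.coMatrix * overlapOperator P Q K).trace.re =
        fidelity (reducedState P B) (reducedState Q B) := by
  obtain ⟨K, hK, h⟩ := exists_contraction_rectTraceNorm
    ((B.coMatrix * P.vecMatrix)ᴴ * (B.coMatrix * Q.vecMatrix))
  refine ⟨Kᵀ, posSemidef_fromBlocks_one_iff.2 (posSemidef_one_sub_transpose hK), ?_⟩
  rw [re_trace_gram_mul_overlapOperator, reducedState_eq, reducedState_eq,
    fidelity_mul_conjTranspose, Matrix.transpose_transpose, h]

/-- A pairing of positive semidefinite matrices is monotone. -/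
theorem re_trace_mul_le_of_le {n : Type*} [Fintype n] [DecidableEq n] {N A B : Matrix n n ℂ}
    (hN : N.PosSemidef) (h : A ≤ B) : (N * A).trace.re ≤ (N * B).trace.re := by
  obtain ⟨C, rfl⟩ := (CStarAlgebra.nonneg_iff_eq_star_mul_self (a := N)).1 hN.nonneg
  have := (Complex.le_def.1 ((Matrix.le_iff.1 h).mul_mul_conjTranspose_same C).trace_nonneg).1
  have h2 : (C * (B - A) * Cᴴ).trace = (star C * C * B).trace - (star C * C * A).trace := by
    rw [Matrix.trace_mul_comm, ← Matrix.mul_assoc, Matrix.mul_sub, Matrix.trace_sub]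
    rfl
  rw [h2] at this
  simpa using this

/-! ### Chain conditions for the Gram operators of a co-strategy -/

/-- The matrix of the map from histories to the last received message and the memory. -/
noncomputable def PureCoPrefix.received {k w : ℕ} (Q : PureCoPrefix X Y k w) :
    Matrix (Y k × Fin w) (Hist Y (k + 1) × Hist X (k + 1)) ℂ :=
  Matrix.of fun b p => if b.1 = p.1 (Fin.last k) then Q.coMatrix b.2 (Fin.init p.1, p.2) else 0

theorem PureCoPrefix.gram_received {k w : ℕ} (Q : PureCoPrefix X Y k w) :
    Q.receivedᴴ * Q.received = tensorNextOutput (Q.coMatrixᴴ * Q.coMatrix) := by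
  ext p q
  simp only [PureCoPrefix.received, Matrix.mul_apply, Matrix.conjTranspose_apply, Matrix.of_apply,
    tensorNextOutput, Fintype.sum_prod_type, Matrix.one_apply, apply_ite star, star_zero, mul_ite,
    mul_zero, ite_mul, zero_mul, mul_one]
  rw [Finset.sum_comm]
  by_cases h : p.1 (Fin.last k) = q.1 (Fin.last k)
  · simp [h]
  · refine (Finset.sum_eq_zero fun m _ => Finset.sum_eq_zero fun b _ => ?_).trans (by simp [h])
    split_ifs with h1 h2
    · exact absurd (h2.symm.trans h1) h
    · rfl
    · rfl

theorem PureCoPrefix.coMatrix_snoc_apply {k w w' : ℕ} (Q : PureCoPrefix X Y k w)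
    (B : Matrix (X (k + 1) × Fin w') (Y k × Fin w) ℂ) (hB : Bᴴ * B = 1) (m : Fin w')
    (q : Hist Y (k + 1) × Hist X (k + 2)) :
    (PureCoPrefix.snoc Q B hB).coMatrix m q =
      (B * Q.received) (q.2 (Fin.last (k + 1)), m) (q.1, Fin.init q.2) := by
  simp only [PureCoPrefix.coMatrix, PureCoPrefix.received, Matrix.of_apply, Matrix.mul_apply,
    Fintype.sum_prod_type, mul_ite, mul_zero]
  rw [Finset.sum_comm]
  simp

theorem PureCoStrategy.coMatrix_final {k w w' : ℕ} (Q : PureCoPrefix X Y k w)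
    (B : Matrix (Fin w') (Y k × Fin w) ℂ) (hB : Bᴴ * B = 1) :
    (PureCoStrategy.final Q B hB).coMatrix = B * Q.received := by
  ext m q
  simp only [PureCoStrategy.coMatrix, PureCoPrefix.received, Matrix.of_apply, Matrix.mul_apply,
    Fintype.sum_prod_type, mul_ite, mul_zero]
  rw [Finset.sum_comm]
  simp

theorem gram_isometry_mul {a b c : Type*} [Fintype a] [Fintype b] [DecidableEq b]
    {B : Matrix a b ℂ} (hB : Bᴴ * B = 1) (E : Matrix b c ℂ) : (B * E)ᴴ * (B * E) = Eᴴ * E := by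
  rw [Matrix.conjTranspose_mul, Matrix.mul_assoc, ← Matrix.mul_assoc Bᴴ, hB, Matrix.one_mul]

/-- The outgoing message is part of the output of the isometry B, so tracing it out of the new Gram
operator gives the Gram matrix of B times `received`, where B cancels. -/
theorem PureCoPrefix.gram_succ {k w w' : ℕ} (Q : PureCoPrefix X Y k w)
    (B : Matrix (X (k + 1) × Fin w') (Y k × Fin w) ℂ) (hB : Bᴴ * B = 1) :
    trLastInput (((PureCoPrefix.snoc Q B hB).coMatrix)ᴴ * (PureCoPrefix.snoc Q B hB).coMatrix) =
      tensorNextOutput (Q.coMatrixᴴ * Q.coMatrix) := by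
  rw [← Q.gram_received, ← gram_isometry_mul hB]
  ext p q
  simp only [trLastInput, Matrix.of_apply, Matrix.mul_apply (M := (B * Q.received)ᴴ),
    Matrix.mul_apply (M := ((PureCoPrefix.snoc Q B hB).coMatrix)ᴴ),
    Matrix.conjTranspose_apply, Fintype.sum_prod_type, PureCoPrefix.coMatrix_snoc_apply,
    Fin.snoc_last, Fin.init_snoc]

theorem PureCoStrategy.gram_final {k w w' : ℕ} (Q : PureCoPrefix X Y k w)
    (B : Matrix (Fin w') (Y k × Fin w) ℂ) (hB : Bᴴ * B = 1) :
    ((PureCoStrategy.final Q B hB).coMatrix)ᴴ * (PureCoStrategy.final Q B hB).coMatrix =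
      tensorNextOutput (Q.coMatrixᴴ * Q.coMatrix) := by
  rw [PureCoStrategy.coMatrix_final, gram_isometry_mul hB, Q.gram_received]

/-- The trace of the Gram matrix of the initial amplitudes is their squared norm. -/
theorem trace_gram_start {w : ℕ} (β : X 0 × Fin w → ℂ)
    (C : Matrix (Fin w) (Hist Y 0 × Hist X 1) ℂ)
    (hC : ∀ m q, C m q = β (q.2 (Fin.last 0), m)) :
    (Cᴴ * C).trace.re = ∑ p, ‖β p‖ ^ 2 := by
  simp only [Matrix.trace, Matrix.diag_apply, Matrix.mul_apply, Matrix.conjTranspose_apply, hC,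
    Fintype.sum_prod_type, sum_hist_succ (X := X), Fin.snoc_last, Complex.re_sum,
    Fintype.sum_subsingleton _ (default : Hist Y 0),
    Fintype.sum_subsingleton _ (default : Hist X 0)]
  refine Finset.sum_congr rfl fun a _ => Finset.sum_congr rfl fun m _ => ?_
  rw [← Complex.normSq_eq_norm_sq, Complex.normSq_apply]
  simp [Complex.mul_re]

/-! ### Weak duality -/

/-- Weak duality along a prefix of a co-strategy. -/
theorem PureCoPrefix.le_re_trace_gram {k w : ℕ} (Q : PureCoPrefix X Y k w) {t : ℝ}
    {R : (j : ℕ) → Matrix (Hist Y j × Hist X j) (Hist Y j × Hist X j) ℂ}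
    (first : (t : ℂ) • (1 : Matrix (Hist Y 0 × Hist X 1) (Hist Y 0 × Hist X 1) ℂ) ≤
      trLastOutput (R 1))
    (step : ∀ j, 1 ≤ j → j ≤ k → tensorNextInput (R j) ≤ trLastOutput (R (j + 1))) :
    t ≤ (Q.coMatrixᴴ * Q.coMatrix * trLastOutput (R (k + 1))).trace.re := by
  induction Q with
  | start β hβ =>
    refine le_trans (le_of_eq ?_)
      (re_trace_mul_le_of_le (Matrix.posSemidef_conjTranspose_mul_self _) first)
    have h := trace_gram_start β (PureCoPrefix.start (Y := Y) β hβ).coMatrix (fun _ _ => rfl)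
    rw [Matrix.mul_smul, Matrix.mul_one, Matrix.trace_smul, smul_eq_mul, Complex.re_ofReal_mul,
      h, hβ, mul_one]
  | @snoc k w w' Q B hB ih =>
    refine (ih fun j h1 h2 => step j h1 (h2.trans k.le_succ)).trans ?_
    -- With N, N' the old and new Gram operators: Tr(N Tr_Y R) = Tr((N ⊗ I) R) = Tr((Tr_X N') R) =
    -- Tr(N' (R ⊗ I)), ready for the next constraint.
    rw [← trace_tensorNextOutput_mul, ← Q.gram_succ B hB, trace_trLastInput_mul]
    exact re_trace_mul_le_of_le (Matrix.posSemidef_conjTranspose_mul_self _)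
      (step (k + 1) (by omega) le_rfl)

/-- Weak duality. -/
theorem SDPFeasible.le_fidelity {r z w : ℕ} {P Q : PureStrategy X Y r z} {t : ℝ}
    {R : (j : ℕ) → Matrix (Hist Y j × Hist X j) (Hist Y j × Hist X j) ℂ}
    {K : Matrix (Fin z) (Fin z) ℂ} (h : SDPFeasible P Q t R K) (B : PureCoStrategy X Y r w) :
    t ≤ fidelity (reducedState P B) (reducedState Q B) := by
  refine le_trans ?_ (re_trace_gram_le_fidelity P Q B h.block)
  refine le_trans ?_ (re_trace_mul_le_of_le (Matrix.posSemidef_conjTranspose_mul_self _) h.last)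
  cases B with
  | @final k w _ C B hB =>
    rw [PureCoStrategy.gram_final C B hB, trace_tensorNextOutput_mul]
    exact C.le_re_trace_gram h.first fun j h1 h2 => h.step j h1 (by omega)

/-! ### Realizing chains by co-strategies -/

/-- Every chain of positive semidefinite operators with the linear constraints of a co-strategy
comes from a prefix of a pure co-strategy. -/
theorem exists_pureCoPrefix_gram [∀ i, Nonempty (X i)] {r : ℕ}
    (N : (j : ℕ) → Matrix (Hist Y j × Hist X (j + 1)) (Hist Y j × Hist X (j + 1)) ℂ)
    (hN : ∀ j < r, (N j).PosSemidef) (h0 : (N 0).trace.re = 1)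
    (hs : ∀ j, j + 1 < r → trLastInput (N (j + 1)) = tensorNextOutput (N j)) (k : ℕ) (hk : k < r) :
    ∃ (w : ℕ) (Q : PureCoPrefix X Y k w), Q.coMatrixᴴ * Q.coMatrix = N k := by
  have gram : ∀ j < r, ∃ F : Matrix (Hist Y j × Hist X (j + 1)) (Hist Y j × Hist X (j + 1)) ℂ,
      Fᴴ * F = N j := fun j hj => by
    obtain ⟨C, hC⟩ := (CStarAlgebra.nonneg_iff_eq_star_mul_self (a := N j)).1 (hN j hj).nonneg
    exact ⟨C, hC.symm⟩
  induction k with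
  | zero =>
    obtain ⟨F, hF⟩ := gram 0 hk
    let e := Fintype.equivFin (Hist Y 0 × Hist X 1)
    -- The initial state is the vectorized factor F of N_0, its row index serving as memory; Tr N_0
    -- = 1 makes it a unit vector.
    let β : X 0 × Fin (Fintype.card (Hist Y 0 × Hist X 1)) → ℂ := fun p =>
      F (e.symm p.2) (default, Fin.snoc (α := fun i : Fin 1 => X i) (default : Hist X 0) p.1)
    have hq : ∀ q : Hist Y 0 × Hist X 1,
        q = (default, Fin.snoc (α := fun i : Fin 1 => X i) (default : Hist X 0)
          (q.2 (Fin.last 0))) := fun q => Prod.ext (Subsingleton.elim _ _)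
        ((Fin.snoc_init_self q.2).symm.trans
          (congrArg (fun p : Hist X 0 => (Fin.snoc (α := fun i : Fin 1 => X i) p
            (q.2 (Fin.last 0)) : Hist X 1)) (Subsingleton.elim _ default)))
    let C : Matrix (Fin (Fintype.card (Hist Y 0 × Hist X 1))) (Hist Y 0 × Hist X 1) ℂ :=
      Matrix.of fun m q => β (q.2 (Fin.last 0), m)
    have hC : C = F.submatrix e.symm id := by
      ext m q
      exact congrArg (F (e.symm m)) (hq q).symm
    have hCC : Cᴴ * C = N 0 := by
      rw [hC, ← hF, Matrix.conjTranspose_submatrix, Matrix.submatrix_mul_equiv]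
      rfl
    have hβ : ∑ p, ‖β p‖ ^ 2 = 1 := by
      rw [← trace_gram_start (Y := Y) β C fun _ _ => rfl, hCC, h0]
    exact ⟨_, .start β hβ, hCC⟩
  | succ k ih =>
    obtain ⟨w, Q, hQ⟩ := ih (by omega)
    obtain ⟨F, hF⟩ := gram (k + 1) hk
    let h := Hist Y (k + 1) × Hist X (k + 2)
    -- D is F with its last input moved to the output side, so D* D is a partial trace and the chain
    -- condition equates it with the Gram matrix of `received`.
    let D : Matrix (X (k + 1) × h) (Hist Y (k + 1) × Hist X (k + 1)) ℂ := Matrix.of fun a p =>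
      F a.2 (p.1, Fin.snoc (α := fun i : Fin (k + 2) => X i) p.2 a.1)
    have hD : Q.receivedᴴ * Q.received = Dᴴ * D := by
      rw [Q.gram_received, hQ, ← hs k hk, ← hF]
      ext p q
      simp only [trLastInput, D, Matrix.of_apply, Matrix.mul_apply, Matrix.conjTranspose_apply]
      rw [Fintype.sum_prod_type]
    obtain ⟨V, U, hVU, hV, hU⟩ := exists_isometry_of_gram_eq Q.received D hD
    obtain ⟨x0⟩ := (inferInstance : Nonempty (X (k + 1)))
    let e := Fintype.equivFin (h ⊕ (Y k × Fin w))
    -- The complementary part U goes to an extra memory summand with the fixed message x0. It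
    -- vanishes on `received`, so it completes the isometry and adds only zero rows to the new
    -- `coMatrix`.
    let B : Matrix (X (k + 1) × (h ⊕ (Y k × Fin w))) (Y k × Fin w) ℂ := Matrix.of fun a b =>
      Sum.elim (fun i => V (a.1, i) b) (fun i => if a.1 = x0 then U i b else 0) a.2
    have hB : Bᴴ * B = 1 := by
      rw [← hVU]
      ext a b
      simp [B, Matrix.mul_apply, Fintype.sum_prod_type, Finset.sum_add_distrib]
    have hBE : ∀ a i p, (B * Q.received) (a, i) p = Sum.elim (fun i => D (a, i) p) (fun _ => 0) i := by
      intro a i p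
      rw [← hV]
      cases i with
      | inl i => rfl
      | inr i =>
        have := congrFun (congrFun hU i) p
        rw [Matrix.mul_apply] at this ⊢
        by_cases ha : a = x0
        · simpa [B, ha] using this
        · simp [B, ha]
    let B' : Matrix (X (k + 1) × Fin (Fintype.card (h ⊕ (Y k × Fin w)))) (Y k × Fin w) ℂ :=
      B.submatrix (Prod.map id e.symm) id
    have hB' : B'ᴴ * B' = 1 := by
      have := Matrix.submatrix_mul_equiv Bᴴ B id ((Equiv.refl _).prodCongr e.symm) id
      rw [hB] at this
      exact this
    refine ⟨_, .snoc Q B' hB', ?_⟩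
    rw [← hF]
    have hc : (PureCoPrefix.snoc Q B' hB').coMatrix =
        (Matrix.of fun i q => Sum.elim (fun j => F j q) (fun _ => 0) i).submatrix e.symm id := by
      ext m q
      rw [PureCoPrefix.coMatrix_snoc_apply]
      refine (hBE (q.2 (Fin.last (k + 1))) (e.symm m) (q.1, Fin.init q.2)).trans ?_
      simp only [D, Matrix.submatrix_apply, Matrix.of_apply, id]
      cases e.symm m with
      | inl i => simp [Fin.snoc_init_self]
      | inr i => rfl
    rw [hc, Matrix.conjTranspose_submatrix, Matrix.submatrix_mul_equiv]
    ext p q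
    simp [Matrix.mul_apply]

/-- The operators of the pure co-strategies include all solutions of the linear constraints. -/
theorem exists_pureCoStrategy_gram [∀ i, Nonempty (X i)] {k : ℕ}
    (N : (j : ℕ) → Matrix (Hist Y j × Hist X (j + 1)) (Hist Y j × Hist X (j + 1)) ℂ)
    (hN : ∀ j < k + 1, (N j).PosSemidef) (h0 : (N 0).trace.re = 1)
    (hs : ∀ j, j + 1 < k + 1 → trLastInput (N (j + 1)) = tensorNextOutput (N j)) :
    ∃ (w : ℕ) (B : PureCoStrategy X Y (k + 1) w),
      B.coMatrixᴴ * B.coMatrix = tensorNextOutput (N k) := by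
  obtain ⟨w, Q, hQ⟩ := exists_pureCoPrefix_gram N hN h0 hs k k.lt_succ_self
  let e := Fintype.equivFin (Y k × Fin w)
  -- The last isometry merely stores the final message in memory.
  let B : Matrix (Fin (Fintype.card (Y k × Fin w))) (Y k × Fin w) ℂ :=
    (1 : Matrix (Y k × Fin w) (Y k × Fin w) ℂ).submatrix e.symm id
  have hB : Bᴴ * B = 1 := by
    rw [Matrix.conjTranspose_submatrix, Matrix.submatrix_mul_equiv]
    simp
  exact ⟨_, .final Q B hB, by rw [PureCoStrategy.gram_final Q B hB, hQ]⟩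

end CoStrategyOperators

/-! ### Compactness and attainment of the optimal value -/

section Attainment

variable {X Y : ℕ → Type*} [∀ i, Fintype (X i)] [∀ i, DecidableEq (X i)]
  [∀ i, Fintype (Y i)] [∀ i, DecidableEq (Y i)]

/-- An entry of a positive semidefinite matrix is bounded by the trace. -/
theorem Matrix.PosSemidef.norm_apply_le_trace {n : Type*} [Fintype n] {A : Matrix n n ℂ}
    (hA : A.PosSemidef) (i j : n) : ‖A i j‖ ≤ A.trace.re := by
  classical
  obtain ⟨C, rfl⟩ := (CStarAlgebra.nonneg_iff_eq_star_mul_self (a := A)).1 hA.nonneg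
  have ht : (star C * C).trace.re = ∑ k, ∑ l, ‖C k l‖ ^ 2 := by
    rw [Finset.sum_comm]
    simp only [Matrix.trace, Matrix.diag_apply, Matrix.mul_apply, Matrix.star_apply,
      Complex.re_sum]
    refine Finset.sum_congr rfl fun l _ => Finset.sum_congr rfl fun k _ => ?_
    rw [← Complex.normSq_eq_norm_sq, Complex.normSq_apply]
    simp [Complex.mul_re]
  rw [ht, Matrix.mul_apply]
  refine (norm_sum_le _ _).trans (Finset.sum_le_sum fun k _ => ?_)
  rw [norm_mul, Matrix.star_apply, norm_star]
  have h : ∀ l, ‖C k l‖ ^ 2 ≤ ∑ l, ‖C k l‖ ^ 2 := fun l =>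
    Finset.single_le_sum (f := fun l => ‖C k l‖ ^ 2) (fun _ _ => sq_nonneg _) (Finset.mem_univ l)
  nlinarith [h i, h j, sq_nonneg (‖C k i‖ - ‖C k j‖)]

theorem isClosed_setOf_posSemidef {n : Type*} [Fintype n] :
    IsClosed {A : Matrix n n ℂ | A.PosSemidef} := by
  simp only [Matrix.posSemidef_iff_dotProduct_mulVec, Matrix.IsHermitian, Set.ofPred_and,
    Set.ofPred_forall]
  refine (isClosed_eq (by fun_prop) (by fun_prop)).inter (isClosed_iInter fun x => ?_)
  exact isClosed_le continuous_const (by fun_prop)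

theorem norm_contraction_apply_le {z : ℕ} {K : Matrix (Fin z) (Fin z) ℂ}
    (hK : (Matrix.fromBlocks 1 K Kᴴ 1).PosSemidef) (i j : Fin z) : ‖K i j‖ ≤ z + z := by
  have := hK.norm_apply_le_trace (Sum.inl i) (Sum.inr j)
  simpa [Matrix.trace] using this

theorem tensorNextInput_smul_one {j : ℕ} (c : ℂ) :
    tensorNextInput (c • (1 : Matrix (Hist Y j × Hist X j) (Hist Y j × Hist X j) ℂ)) = c • 1 := by
  ext p q
  simp only [tensorNextInput, Matrix.of_apply, Matrix.smul_apply, smul_eq_mul, Matrix.one_apply,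
    Prod.ext_iff]
  have : p.2 = q.2 ↔ (fun i : Fin j => p.2 i.castSucc) = (fun i : Fin j => q.2 i.castSucc) ∧
      p.2 (Fin.last j) = q.2 (Fin.last j) := by
    constructor
    · intro h; rw [h]; exact ⟨rfl, rfl⟩
    · rintro ⟨h1, h2⟩
      funext i
      refine Fin.lastCases h2 (fun i => congrFun h1 i) i
  simp only [this]
  split_ifs <;> simp_all

theorem tensorNextOutput_one {j k : ℕ} :
    tensorNextOutput (1 : Matrix (Hist Y j × Hist X k) (Hist Y j × Hist X k) ℂ) = 1 := by
  ext p q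
  simp only [tensorNextOutput, Matrix.of_apply, Matrix.one_apply, Prod.ext_iff]
  have : p.1 = q.1 ↔ Fin.init p.1 = Fin.init q.1 ∧ p.1 (Fin.last j) = q.1 (Fin.last j) := by
    constructor
    · intro h; rw [h]; exact ⟨rfl, rfl⟩
    · rintro ⟨h1, h2⟩
      funext i
      refine Fin.lastCases h2 (fun i => congrFun h1 i) i
  simp only [this]
  split_ifs <;> simp_all

theorem trLastInput_one {j k : ℕ} :
    trLastInput (1 : Matrix (Hist Y j × Hist X (k + 1)) (Hist Y j × Hist X (k + 1)) ℂ) =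
      (Fintype.card (X k) : ℂ) • 1 := by
  ext p q
  simp only [trLastInput, Matrix.of_apply, Matrix.one_apply, Prod.ext_iff, Matrix.smul_apply,
    Fin.snoc_inj, and_true]
  simp

theorem trace_trLastOutput {j k : ℕ}
    (R : Matrix (Hist Y (j + 1) × Hist X k) (Hist Y (j + 1) × Hist X k) ℂ) :
    (trLastOutput R).trace = R.trace := by
  have := trace_tensorNextOutput_mul 1 R
  rw [tensorNextOutput_one, Matrix.one_mul, Matrix.one_mul] at this
  exact this.symm

theorem trace_tensorNextInput {j : ℕ}
    (R : Matrix (Hist Y j × Hist X j) (Hist Y j × Hist X j) ℂ) :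
    (tensorNextInput R).trace = Fintype.card (X j) * R.trace := by
  have := trace_trLastInput_mul 1 R
  rw [trLastInput_one, Matrix.smul_mul, Matrix.one_mul, Matrix.one_mul, Matrix.trace_smul] at this
  exact this.symm

theorem continuous_trLastOutput {j k : ℕ} : Continuous (trLastOutput :
    Matrix (Hist Y (j + 1) × Hist X k) (Hist Y (j + 1) × Hist X k) ℂ → _) := by
  unfold trLastOutput
  fun_prop

theorem continuous_tensorNextInput {j : ℕ} : Continuous (tensorNextInput :
    Matrix (Hist Y j × Hist X j) (Hist Y j × Hist X j) ℂ → _) := by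
  unfold tensorNextInput
  fun_prop

theorem continuous_overlapOperator {r z : ℕ} (P Q : PureStrategy X Y r z) :
    Continuous (overlapOperator P Q) := by
  simp only [funext (overlapOperator_eq P Q)]
  fun_prop

/-- The feasible points of the semidefinite program with the objective value stored in `R 0`. -/
structure ChainFeasible {r z : ℕ} (P Q : PureStrategy X Y r z)
    (R : (j : ℕ) → Matrix (Hist Y j × Hist X j) (Hist Y j × Hist X j) ℂ)
    (K : Matrix (Fin z) (Fin z) ℂ) : Prop where
  hermitian : ∀ j, j ≤ r → (R j).IsHermitian
  step : ∀ j, j < r → (trLastOutput (R (j + 1)) - tensorNextInput (R j)).PosSemidef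
  last : (overlapOperator P Q K - R r).PosSemidef
  block : (Matrix.fromBlocks 1 K Kᴴ 1).PosSemidef

theorem ChainFeasible.sdpFeasible {r z : ℕ} {P Q : PureStrategy X Y r z} {t : ℝ}
    {R : (j : ℕ) → Matrix (Hist Y j × Hist X j) (Hist Y j × Hist X j) ℂ}
    {K : Matrix (Fin z) (Fin z) ℂ} (h : ChainFeasible P Q R K) (hr : 1 ≤ r)
    (h0 : R 0 = (t : ℂ) • 1) : SDPFeasible P Q t R K where
  hermitian j _ := h.hermitian j
  first := by
    have := h.step 0 hr
    rw [h0, tensorNextInput_smul_one] at this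
    exact Matrix.le_iff.2 this
  step j _ hj := Matrix.le_iff.2 (h.step j hj)
  last := Matrix.le_iff.2 h.last
  block := h.block

/-- The zeroth history spaces are one-dimensional, so t is itself an operator R 0 and the first
constraint becomes the step j = 0. Irrelevant stages are zeroed for compactness. -/
theorem SDPFeasible.chainFeasible {r z : ℕ} {P Q : PureStrategy X Y r z} {t : ℝ}
    {R : (j : ℕ) → Matrix (Hist Y j × Hist X j) (Hist Y j × Hist X j) ℂ}
    {K : Matrix (Fin z) (Fin z) ℂ} (h : SDPFeasible P Q t R K) (hr : 1 ≤ r) :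
    ChainFeasible P Q (fun j => if j = 0 then (t : ℂ) • 1 else if j ≤ r then R j else 0) K where
  hermitian j hj := by
    by_cases h0 : j = 0
    · subst h0
      simp [Matrix.IsHermitian, Matrix.conjTranspose_smul]
    · simpa [h0, hj] using h.hermitian j (by omega) hj
  step j hj := by
    by_cases h0 : j = 0
    · subst h0
      simp only [↓reduceIte, zero_add, one_ne_zero, hr, tensorNextInput_smul_one]
      exact Matrix.le_iff.1 h.first
    · have := Matrix.le_iff.1 (h.step j (by omega) hj)
      simpa [h0, hj, hj.le, Nat.succ_le_of_lt hj] using this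
  last := by
    have := Matrix.le_iff.1 h.last
    simpa [show r ≠ 0 by omega] using this
  block := h.block

theorem tensorNextInput_snoc {j : ℕ} (R : Matrix (Hist Y j × Hist X j) (Hist Y j × Hist X j) ℂ)
    (p q : Hist Y j × Hist X j) (a : X j) :
    tensorNextInput R (p.1, Fin.snoc (α := fun i => X i) p.2 a)
      (q.1, Fin.snoc (α := fun i => X i) q.2 a) = R p q := by
  change R (p.1, fun i : Fin j => (Fin.snoc (α := fun i : Fin (j + 1) => X i) p.2 a) i.castSucc)
    (q.1, fun i : Fin j => (Fin.snoc (α := fun i : Fin (j + 1) => X i) q.2 a) i.castSucc) *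
    (1 : Matrix (X j) (X j) ℂ) ((Fin.snoc (α := fun i : Fin (j + 1) => X i) p.2 a) (Fin.last j))
      ((Fin.snoc (α := fun i : Fin (j + 1) => X i) q.2 a) (Fin.last j)) = R p q
  have h : ∀ x : Hist X j,
      ((Fin.snoc (α := fun i : Fin (j + 1) => X i) x a) (Fin.last j) : X j) = a :=
    fun x => Fin.snoc_last _ _
  simp only [Fin.snoc_castSucc]
  exact (congrArg₂ (fun u v => R p q * (1 : Matrix (X j) (X j) ℂ) u v) (h _) (h _)).trans
    (by simp)

/-- Downward bound for the operators of a feasible point. -/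
theorem norm_apply_le_of_step [∀ i, Nonempty (X i)] {j : ℕ} {b : ℝ}
    {R : Matrix (Hist Y j × Hist X j) (Hist Y j × Hist X j) ℂ}
    {R' : Matrix (Hist Y (j + 1) × Hist X (j + 1)) (Hist Y (j + 1) × Hist X (j + 1)) ℂ}
    (h : (trLastOutput R' - tensorNextInput R).PosSemidef) (hR : 0 ≤ R.trace.re)
    (hb : ∀ p q, ‖R' p q‖ ≤ b) (p q : Hist Y j × Hist X j) :
    ‖R p q‖ ≤ Fintype.card (Y j) * b + Fintype.card (Hist Y (j + 1) × Hist X (j + 1)) * b := by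
  obtain ⟨a⟩ := (inferInstance : Nonempty (X j))
  have e1 : R p q = tensorNextInput R (p.1, Fin.snoc (α := fun i => X i) p.2 a)
      (q.1, Fin.snoc (α := fun i => X i) q.2 a) := (tensorNextInput_snoc R p q a).symm
  set p' : Hist Y j × Hist X (j + 1) := (p.1, Fin.snoc (α := fun i => X i) p.2 a)
  set q' : Hist Y j × Hist X (j + 1) := (q.1, Fin.snoc (α := fun i => X i) q.2 a)
  have e2 : R p q = trLastOutput R' p' q' - (trLastOutput R' - tensorNextInput R) p' q' := by
    rw [e1, Matrix.sub_apply]; ring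
  have h1 : ‖trLastOutput R' p' q'‖ ≤ Fintype.card (Y j) * b := by
    refine (norm_sum_le _ _).trans ((Finset.sum_le_sum fun c _ => hb _ _).trans ?_)
    simp
  have h2 := h.norm_apply_le_trace p' q'
  rw [Matrix.trace_sub, trace_trLastOutput, trace_tensorNextInput, Complex.sub_re,
    ← Complex.ofReal_natCast,
      Complex.re_ofReal_mul] at h2
  have h3 : R'.trace.re ≤ Fintype.card (Hist Y (j + 1) × Hist X (j + 1)) * b := by
    refine (Complex.re_le_norm _).trans ((norm_sum_le _ _).trans
      ((Finset.sum_le_sum fun c _ => hb _ _).trans ?_))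
    simp
  have h4 : 0 ≤ (Fintype.card (X j) : ℝ) * R.trace.re := by positivity
  rw [e2]
  exact (norm_sub_le _ _).trans (by linarith)

/-- The trace of a step constraint reads Tr R_{j+1} ≥ dim(X_j) Tr R_j, so nonnegativity propagates
upwards. -/
theorem ChainFeasible.trace_nonneg {r z : ℕ} {P Q : PureStrategy X Y r z}
    {R : (j : ℕ) → Matrix (Hist Y j × Hist X j) (Hist Y j × Hist X j) ℂ}
    {K : Matrix (Fin z) (Fin z) ℂ} (h : ChainFeasible P Q R K) (h0 : 0 ≤ (R 0).trace.re) :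
    ∀ j ≤ r, 0 ≤ (R j).trace.re := by
  intro j
  induction j with
  | zero => exact fun _ => h0
  | succ j ih =>
    intro hj
    have h1 := (Complex.le_def.1 (h.step j hj).trace_nonneg).1
    rw [Matrix.trace_sub, trace_trLastOutput, trace_tensorNextInput, Complex.sub_re,
      ← Complex.ofReal_natCast,
      Complex.re_ofReal_mul] at h1
    have h2 : 0 ≤ (Fintype.card (X j) : ℝ) * (R j).trace.re :=
      mul_nonneg (Nat.cast_nonneg _) (ih (by omega))
    simp only [Complex.zero_re] at h1
    linarith

theorem isCompact_setOf_entries_mem_closedBall {m n : Type*} (b : ℝ) :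
    IsCompact {M : Matrix m n ℂ | ∀ p q, M p q ∈ Metric.closedBall (0 : ℂ) b} := by
  have := isCompact_univ_pi (X := fun _ : m => n → ℂ) fun _ =>
    isCompact_univ_pi (X := fun _ : n => ℂ) fun _ => isCompact_closedBall (0 : ℂ) b
  convert! this using 1
  ext M
  exact ⟨fun h p _ q _ => h p q, fun h p q => h p trivial q trivial⟩

theorem isCompact_contractions (z : ℕ) :
    IsCompact {K : Matrix (Fin z) (Fin z) ℂ | (Matrix.fromBlocks 1 K Kᴴ 1).PosSemidef} := by
  refine (isCompact_setOf_entries_mem_closedBall (z + z : ℝ)).of_isClosed_subset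
    (isClosed_setOf_posSemidef.preimage ?_) fun K hK p q => ?_
  · exact Continuous.matrix_fromBlocks continuous_const continuous_id (by fun_prop)
      continuous_const
  · simpa using norm_contraction_apply_le hK p q

theorem exists_norm_overlapOperator_apply_le {r z : ℕ} (P Q : PureStrategy X Y r z) :
    ∃ b : ℝ, ∀ K : Matrix (Fin z) (Fin z) ℂ, (Matrix.fromBlocks 1 K Kᴴ 1).PosSemidef →
      ∀ p q, ‖overlapOperator P Q K p q‖ ≤ b := by
  have hc := continuous_overlapOperator P Q
  obtain ⟨b, hb⟩ := (isCompact_contractions z).exists_bound_of_continuousOn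
    (f := fun K => ∑ p, ∑ q, ‖overlapOperator P Q K p q‖)
    (Continuous.continuousOn (continuous_finsetSum _ fun p _ => continuous_finsetSum _ fun q _ =>
      (hc.matrix_elem p q).norm))
  refine ⟨b, fun K hK p q => ?_⟩
  refine le_trans ?_ ((Real.le_norm_self _).trans (hb K hK))
  refine le_trans ?_ (Finset.single_le_sum (f := fun p => ∑ q, ‖overlapOperator P Q K p q‖)
    (fun _ _ => Finset.sum_nonneg fun _ _ => norm_nonneg _) (Finset.mem_univ p))
  exact Finset.single_le_sum (f := fun q => ‖overlapOperator P Q K p q‖)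
    (fun _ _ => norm_nonneg _) (Finset.mem_univ q)

/-- The feasible points with nonnegative objective value are bounded. -/
theorem exists_norm_chainFeasible_apply_le [∀ i, Nonempty (X i)] {r z : ℕ}
    (P Q : PureStrategy X Y r z) : ∃ b : ℕ → ℝ, ∀ R K, ChainFeasible P Q R K →
      0 ≤ (R 0).trace.re → ∀ j ≤ r, ∀ p q, ‖R j p q‖ ≤ b j := by
  obtain ⟨b, hb⟩ := exists_norm_overlapOperator_apply_le P Q
  have main : ∀ i ≤ r, ∃ c : ℝ, ∀ R K, ChainFeasible P Q R K → 0 ≤ (R 0).trace.re →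
      ∀ p q, ‖R (r - i) p q‖ ≤ c := by
    intro i
    induction i with
    | zero =>
      intro _
      -- R_r is the overlap operator minus a positive slack. Entries of the slack are at most its
      -- trace, which is at most that of the overlap operator because Tr R_r ≥ 0.
      refine ⟨b + Fintype.card (Hist Y r × Hist X r) * b, fun R K h h0 p q => ?_⟩
      have h1 := h.last.norm_apply_le_trace p q
      have h2 := h.trace_nonneg h0 r le_rfl
      have h3 : (overlapOperator P Q K).trace.re ≤ Fintype.card (Hist Y r × Hist X r) * b := by
        refine (Complex.re_le_norm _).trans ((norm_sum_le _ _).trans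
          ((Finset.sum_le_sum fun c _ => hb K h.block _ _).trans ?_))
        simp
      rw [Matrix.trace_sub, Complex.sub_re] at h1
      have e : R r p q = overlapOperator P Q K p q - (overlapOperator P Q K - R r) p q := by
        rw [Matrix.sub_apply]; ring
      change ‖R r p q‖ ≤ _
      rw [e]
      refine (norm_sub_le _ _).trans ?_
      linarith [hb K h.block p q]
    | succ i ih =>
      intro hi
      obtain ⟨c, hc⟩ := ih (by omega)
      obtain ⟨j, hj⟩ : ∃ j, j = r - (i + 1) := ⟨_, rfl⟩
      rw [show r - i = j + 1 by omega] at hc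
      rw [← hj]
      exact ⟨_, fun R K h h0 => norm_apply_le_of_step (h.step j (by omega))
        (h.trace_nonneg h0 j (by omega)) (hc R K h h0)⟩
  choose! c hc using main
  exact ⟨fun j => c (r - j), fun R K h h0 j hj => by
    have := hc (r - j) (by omega) R K h h0
    rwa [Nat.sub_sub_self hj] at this⟩

theorem isClosed_setOf_chainFeasible {r z : ℕ} (P Q : PureStrategy X Y r z) :
    IsClosed {e : ((j : ℕ) → Matrix (Hist Y j × Hist X j) (Hist Y j × Hist X j) ℂ) ×
      Matrix (Fin z) (Fin z) ℂ | ChainFeasible P Q e.1 e.2} := by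
  have hR : ∀ j, Continuous fun e : ((j : ℕ) → Matrix (Hist Y j × Hist X j)
      (Hist Y j × Hist X j) ℂ) × Matrix (Fin z) (Fin z) ℂ => e.1 j := fun j =>
    (continuous_apply j).comp continuous_fst
  have h1 := isClosed_biInter (s := {j | j ≤ r}) fun j _ =>
    isClosed_eq (hR j).matrix_conjTranspose (hR j)
  have h2 := isClosed_biInter (s := {j | j < r}) fun j _ => isClosed_setOf_posSemidef.preimage
    ((continuous_trLastOutput.comp (hR (j + 1))).sub (continuous_tensorNextInput.comp (hR j)))
  have h3 := isClosed_setOf_posSemidef.preimage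
    (((continuous_overlapOperator P Q).comp continuous_snd).sub (hR r))
  have h4 := (isCompact_contractions z).isClosed.preimage (continuous_snd
    (X := (j : ℕ) → Matrix (Hist Y j × Hist X j) (Hist Y j × Hist X j) ℂ))
  convert! ((h1.inter h2).inter h3).inter h4 using 1
  ext e
  simp only [Set.mem_inter_iff, Set.mem_iInter, Set.mem_ofPred_eq, Set.mem_preimage]
  exact ⟨fun h => ⟨⟨⟨h.hermitian, h.step⟩, h.last⟩, h.block⟩,
    fun h => ⟨h.1.1.1, h.1.1.2, h.1.2, h.2⟩⟩

theorem sdpFeasible_zero {r z : ℕ} (P Q : PureStrategy X Y r z) :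
    SDPFeasible P Q 0 (fun _ => 0) 0 where
  hermitian _ _ _ := Matrix.isHermitian_zero
  first := le_of_eq (by ext; simp [trLastOutput])
  step _ _ _ := le_of_eq (by ext; simp [trLastOutput, tensorNextInput])
  last := le_of_eq (by simp [overlapOperator_eq])
  block := by
    rw [Matrix.conjTranspose_zero, Matrix.fromBlocks_one]
    exact Matrix.PosSemidef.one

/-- The optimal value of the semidefinite program is attained. -/
theorem exists_isGreatest_sdpValues [∀ i, Nonempty (X i)] {r z : ℕ} (hr : 1 ≤ r)
    (P Q : PureStrategy X Y r z) : ∃ t, IsGreatest (sdpValues P Q) t := by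
  obtain ⟨b, hb⟩ := exists_norm_chainFeasible_apply_le P Q
  let d : Hist Y 0 × Hist X 0 := (default, default)
  have hR : ∀ j, Continuous fun e : ((j : ℕ) → Matrix (Hist Y j × Hist X j)
      (Hist Y j × Hist X j) ℂ) × Matrix (Fin z) (Fin z) ℂ => e.1 j := fun j =>
    (continuous_apply j).comp continuous_fst
  have hτ : Continuous fun e : ((j : ℕ) → Matrix (Hist Y j × Hist X j)
      (Hist Y j × Hist X j) ℂ) × Matrix (Fin z) (Fin z) ℂ => (e.1 0 d d).re :=
    Complex.continuous_re.comp ((hR 0).matrix_elem d d)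
  have htr : ∀ M : Matrix (Hist Y 0 × Hist X 0) (Hist Y 0 × Hist X 0) ℂ, M.trace = M d d :=
    fun M => Fintype.sum_subsingleton _ d
  have hone : ∀ c : ℂ,
      (c • (1 : Matrix (Hist Y 0 × Hist X 0) (Hist Y 0 × Hist X 0) ℂ)) d d = c := by simp
  -- Restricting to t ≥ 0 loses nothing, as the zero point is feasible, and it bounds the stages up
  -- to r; the later stages are pinned to 0.
  let F : Set (((j : ℕ) → Matrix (Hist Y j × Hist X j) (Hist Y j × Hist X j) ℂ) ×
      Matrix (Fin z) (Fin z) ℂ) := {e | ChainFeasible P Q e.1 e.2} ∩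
    ({e | 0 ≤ (e.1 0 d d).re} ∩ ⋂ j ∈ {j | r < j}, {e | e.1 j = 0})
  have hF : IsCompact F := by
    refine ((isCompact_univ_pi fun j =>
      isCompact_setOf_entries_mem_closedBall (if j ≤ r then b j else 0)).prod
      (isCompact_setOf_entries_mem_closedBall (z + z : ℝ))).of_isClosed_subset
      ((isClosed_setOf_chainFeasible P Q).inter ((isClosed_le continuous_const hτ).inter
        (isClosed_biInter fun j _ => isClosed_eq (hR j) continuous_const))) ?_
    rintro ⟨R, K⟩ ⟨h1, h2, h3⟩
    refine ⟨fun j _ p q => ?_, fun p q => by simpa using norm_contraction_apply_le h1.block p q⟩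
    by_cases hj : j ≤ r
    · simpa [hj] using hb R K h1 (by rw [htr]; exact h2) j hj p q
    · have : R j = 0 := by simpa using Set.mem_iInter₂.1 h3 j (not_le.1 hj)
      simp [this, hj]
  have hmem : ∀ (t : ℝ) R K, SDPFeasible P Q t R K → 0 ≤ t →
      ((fun j => if j = 0 then (t : ℂ) • 1 else if j ≤ r then R j else 0), K) ∈ F := by
    intro t R K h ht
    refine ⟨h.chainFeasible hr, ?_, Set.mem_iInter₂.2 fun j hj => ?_⟩
    · simpa using ht
    · have hj : r < j := hj
      simp [show j ≠ 0 by omega, show ¬ j ≤ r by omega]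
  obtain ⟨⟨R, K⟩, hm, hmax⟩ := hF.exists_isMaxOn ⟨_, hmem 0 _ _ (sdpFeasible_zero P Q) le_rfl⟩ hτ.continuousOn
  refine ⟨(R 0 d d).re, ⟨R, K, hm.1.sdpFeasible hr ?_⟩, ?_⟩
  · have hh : star (R 0 d d) = R 0 d d := congrFun (congrFun (hm.1.hermitian 0 (Nat.zero_le r)) d) d
    ext p q
    rw [Subsingleton.elim p d, Subsingleton.elim q d, hone]
    exact (Complex.conj_eq_iff_re.1 hh).symm
  · rintro t ⟨R', K', h⟩
    by_cases ht : 0 ≤ t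
    · have := hmax (hmem t R' K' h ht)
      simpa using this
    · exact (not_le.1 ht).le.trans hm.2.1

end Attainment

/-! ### Strong duality by separation -/

section Duality

variable {X Y : ℕ → Type*} [∀ i, Fintype (X i)] [∀ i, DecidableEq (X i)]
  [∀ i, Fintype (Y i)] [∀ i, DecidableEq (Y i)]

/-- A real-linear functional on Hermitian matrices is the trace pairing with a Hermitian matrix. -/
theorem exists_isHermitian_trace_repr {n : Type*} [Fintype n] [DecidableEq n]
    (l : Matrix n n ℂ →ₗ[ℝ] ℝ) :
    ∃ N : Matrix n n ℂ, N.IsHermitian ∧ ∀ A : Matrix n n ℂ, A.IsHermitian →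
      l A = (N * A).trace.re := by
  -- The signs are chosen so that Re(M q p · a) is the value of l at the matrix unit (p, q) times a.
  -- Passing to the Hermitian part does not change pairings with Hermitian matrices.
  let M : Matrix n n ℂ := Matrix.of fun q p =>
    ⟨l (Matrix.single p q 1), -l (Matrix.single p q Complex.I)⟩
  have hM : ∀ A, l A = (M * A).trace.re := by
    intro A
    have hs : ∀ p q, l (Matrix.single p q (A p q)) = (M q p * A p q).re := by
      intro p q
      have e : Matrix.single p q (A p q) = (A p q).re • Matrix.single p q (1 : ℂ) +
          (A p q).im • Matrix.single p q Complex.I := by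
        rw [Matrix.smul_single, Matrix.smul_single, ← Matrix.single_add]
        congr 1
        apply Complex.ext <;> simp
      rw [e, map_add, map_smul, map_smul]
      simp [M, Complex.mul_re]
      ring
    conv_lhs => rw [Matrix.matrix_eq_sum_single A]
    simp only [map_sum, hs, Matrix.trace, Matrix.diag_apply, Matrix.mul_apply, Complex.re_sum]
    exact Finset.sum_comm
  refine ⟨(1 / 2 : ℂ) • (M + Mᴴ), ?_, fun A hA => ?_⟩
  · rw [Matrix.IsHermitian, Matrix.conjTranspose_smul, Matrix.conjTranspose_add,
      Matrix.conjTranspose_conjTranspose, add_comm]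
    simp
  · have h := re_trace_conjTranspose_mul (B := M) hA
    rw [Matrix.trace_mul_comm, Matrix.trace_mul_comm A M] at h
    rw [hM, Matrix.smul_mul, Matrix.add_mul, Matrix.trace_smul, Matrix.trace_add, smul_eq_mul]
    have h3 : ∀ a b : ℂ, b.re = a.re → a.re = (1 / 2 * (a + b)).re := fun a b hab => by
      simp only [one_div, Complex.mul_re, Complex.inv_re, Complex.add_re, hab]
      norm_num
      ring
    exact h3 _ _ h

/-- Matrices whose numerical range has positive real part form an open set. -/
theorem isOpen_setOf_forall_sphere_re_pos {n : Type*} [Fintype n] :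
    IsOpen {A : Matrix n n ℂ | ∀ x ∈ Metric.sphere (0 : n → ℂ) 1,
      0 < (star x ⬝ᵥ A *ᵥ x).re} := by
  rw [isOpen_iff_eventually]
  intro A hA
  -- Positivity is open at each x; compactness of the sphere makes it uniform.
  refine (isCompact_sphere (0 : n → ℂ) 1).eventually_forall_of_forall_eventually fun x hx => ?_
  have hc : Continuous fun p : Matrix n n ℂ × (n → ℂ) => (star p.2 ⬝ᵥ p.1 *ᵥ p.2).re := by
    fun_prop
  exact hc.continuousAt.eventually (lt_mem_nhds (hA x hx))

theorem posSemidef_of_sphere {n : Type*} [Fintype n] {A : Matrix n n ℂ} (hA : A.IsHermitian)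
    (h : ∀ x ∈ Metric.sphere (0 : n → ℂ) 1, 0 < (star x ⬝ᵥ A *ᵥ x).re) : A.PosSemidef := by
  refine Matrix.PosSemidef.of_dotProduct_mulVec_nonneg hA fun x => ?_
  have him : (star x ⬝ᵥ A *ᵥ x).im = 0 := hA.im_star_dotProduct_mulVec_self x
  rw [Complex.le_def]
  refine ⟨?_, him.symm⟩
  by_cases hx : x = 0
  · simp [hx]
  have hn : 0 < ‖x‖ := norm_pos_iff.2 hx
  have h1 := h (((‖x‖⁻¹ : ℝ) : ℂ) • x) (by
    rw [mem_sphere_zero_iff_norm, norm_smul, Complex.norm_real, norm_inv, norm_norm,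
      inv_mul_cancel₀ hn.ne'])
  rw [star_smul, Matrix.mulVec_smul, smul_dotProduct, dotProduct_smul] at h1
  simp only [smul_eq_mul, RCLike.star_def, Complex.conj_ofReal, Complex.re_ofReal_mul] at h1
  have h2 : 0 < ‖x‖⁻¹ := inv_pos.2 hn
  exact (pos_of_mul_pos_right (pos_of_mul_pos_right h1 h2.le) h2.le).le

theorem re_star_dotProduct_mulVec_nonneg {n : Type*} [Fintype n] {A : Matrix n n ℂ}
    (hA : A.PosSemidef) (x : n → ℂ) : 0 ≤ (star x ⬝ᵥ A *ᵥ x).re :=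
  (Complex.le_def.1 (hA.dotProduct_mulVec_nonneg x)).1

/-- The slack operators of the chain of constraints. -/
def chainSlack (r : ℕ) (R : (j : ℕ) → Matrix (Hist Y j × Hist X j) (Hist Y j × Hist X j) ℂ)
    (j : ℕ) : Matrix (Hist Y j × Hist X (j + 1)) (Hist Y j × Hist X (j + 1)) ℂ :=
  if j < r then trLastOutput (R (j + 1)) - tensorNextInput (R j) else 0

theorem chainSlack_comb (r : ℕ)
    (R R' : (j : ℕ) → Matrix (Hist Y j × Hist X j) (Hist Y j × Hist X j) ℂ) (a b : ℝ) :
    chainSlack r (a • R + b • R') = a • chainSlack r R + b • chainSlack r R' := by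
  funext j
  simp only [chainSlack, Pi.add_apply, Pi.smul_apply]
  split_ifs
  · ext p q
    simp [trLastOutput, tensorNextInput, Finset.sum_add_distrib, ← Finset.mul_sum]
    ring
  · simp

theorem trLastOutput_isHermitian {j k : ℕ}
    {R : Matrix (Hist Y (j + 1) × Hist X k) (Hist Y (j + 1) × Hist X k) ℂ} (hR : R.IsHermitian) :
    (trLastOutput R).IsHermitian := by
  ext p q
  simp only [trLastOutput, Matrix.conjTranspose_apply, Matrix.of_apply, star_sum]
  exact Finset.sum_congr rfl fun b _ => hR.apply _ _

theorem tensorNextInput_isHermitian {j : ℕ}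
    {R : Matrix (Hist Y j × Hist X j) (Hist Y j × Hist X j) ℂ} (hR : R.IsHermitian) :
    (tensorNextInput R).IsHermitian := by
  ext p q
  simp only [tensorNextInput, Matrix.conjTranspose_apply, Matrix.of_apply, star_mul']
  exact congrArg₂ _ (hR.apply _ _) (Matrix.isHermitian_one.apply _ _)

theorem tensorNextOutput_isHermitian {j k : ℕ}
    {R : Matrix (Hist Y j × Hist X k) (Hist Y j × Hist X k) ℂ} (hR : R.IsHermitian) :
    (tensorNextOutput R).IsHermitian := by
  ext p q
  simp only [tensorNextOutput, Matrix.conjTranspose_apply, Matrix.of_apply, star_mul']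
  exact congrArg₂ _ (hR.apply _ _) (Matrix.isHermitian_one.apply _ _)

theorem trLastInput_isHermitian {j k : ℕ}
    {R : Matrix (Hist Y j × Hist X (k + 1)) (Hist Y j × Hist X (k + 1)) ℂ} (hR : R.IsHermitian) :
    (trLastInput R).IsHermitian := by
  ext p q
  simp only [trLastInput, Matrix.conjTranspose_apply, Matrix.of_apply, star_sum]
  exact Finset.sum_congr rfl fun b _ => hR.apply _ _

theorem chainSlack_isHermitian {r : ℕ}
    {R : (j : ℕ) → Matrix (Hist Y j × Hist X j) (Hist Y j × Hist X j) ℂ}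
    (hR : ∀ j, (R j).IsHermitian) (j : ℕ) : (chainSlack r R j).IsHermitian := by
  unfold chainSlack
  split_ifs
  · exact (trLastOutput_isHermitian (hR _)).sub (tensorNextInput_isHermitian (hR _))
  · exact Matrix.isHermitian_zero

theorem overlapOperator_comb {r z : ℕ} (P Q : PureStrategy X Y r z)
    (K K' : Matrix (Fin z) (Fin z) ℂ) (a b : ℝ) :
    overlapOperator P Q (a • K + b • K') =
      a • overlapOperator P Q K + b • overlapOperator P Q K' := by
  have h : Q.vecMatrix * (a • K + b • K')ᵀ * P.vecMatrixᴴ =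
      a • (Q.vecMatrix * Kᵀ * P.vecMatrixᴴ) + b • (Q.vecMatrix * K'ᵀ * P.vecMatrixᴴ) := by
    simp only [Matrix.transpose_add, Matrix.transpose_smul, Matrix.mul_add, Matrix.add_mul,
      Matrix.mul_smul, Matrix.smul_mul]
  simp only [overlapOperator_eq, h, Matrix.conjTranspose_add, Matrix.conjTranspose_smul,
    star_trivial, smul_comm a (1 / 2 : ℂ), smul_comm b (1 / 2 : ℂ), ← smul_add]
  congr 1
  simp only [smul_add]
  abel

theorem posSemidef_comb {n : Type*} [Fintype n] {A B : Matrix n n ℂ} (hA : A.PosSemidef)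
    (hB : B.PosSemidef) {a b : ℝ} (ha : 0 ≤ a) (hb : 0 ≤ b) : (a • A + b • B).PosSemidef :=
  (hA.smul ha).add (hB.smul hb)

/-- Separation of the slack operators from the positive definite ones. -/
theorem exists_separating_chain {r z : ℕ} (hr : 1 ≤ r) {P Q : PureStrategy X Y r z} {v : ℝ}
    (hv : v ∈ upperBounds (sdpValues P Q)) :
    ∃ (N : (j : ℕ) → Matrix (Hist Y j × Hist X (j + 1)) (Hist Y j × Hist X (j + 1)) ℂ) (u : ℝ),
      0 ≤ u ∧ (∀ j < r, (N j).PosSemidef) ∧ -u < ∑ j ∈ Finset.range r, (N j).trace.re ∧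
      ∀ (R : (j : ℕ) → Matrix (Hist Y j × Hist X j) (Hist Y j × Hist X j) ℂ)
        (K : Matrix (Fin z) (Fin z) ℂ), (∀ j, (R j).IsHermitian) → R 0 = (v : ℂ) • 1 → R r = overlapOperator P Q K →
        (Matrix.fromBlocks 1 K Kᴴ 1).PosSemidef →
        ∑ j ∈ Finset.range r,
          (N j * (trLastOutput (R (j + 1)) - tensorNextInput (R j))).trace.re ≤ -u := by
  -- Hermitian positive definite tuples are not open among all complex tuples, so U asks only for
  -- positive real part of the quadratic form; on Hermitian matrices this is positive definiteness.
  let U : Set ((j : ℕ) → Matrix (Hist Y j × Hist X (j + 1)) (Hist Y j × Hist X (j + 1)) ℂ) :=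
    {A | ∀ j < r, ∀ x ∈ Metric.sphere (0 : Hist Y j × Hist X (j + 1) → ℂ) 1,
      0 < (star x ⬝ᵥ A j *ᵥ x).re}
  let C : Set ((j : ℕ) → Matrix (Hist Y j × Hist X (j + 1)) (Hist Y j × Hist X (j + 1)) ℂ) :=
    {A | ∃ R K, (∀ j, (R j).IsHermitian) ∧ R 0 = (v : ℂ) • 1 ∧ R r = overlapOperator P Q K ∧
        (Matrix.fromBlocks 1 K Kᴴ 1).PosSemidef ∧ A = chainSlack r R}
  have hUo : IsOpen U := by
    have : U = ⋂ j ∈ {j | j < r}, (fun A => A j) ⁻¹' {A | ∀ x ∈ Metric.sphere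
        (0 : Hist Y j × Hist X (j + 1) → ℂ) 1, 0 < (star x ⬝ᵥ A *ᵥ x).re} := by
      ext A
      simp [U]
    rw [this]
    exact (Set.finite_lt_nat r).isOpen_biInter fun j _ =>
      isOpen_setOf_forall_sphere_re_pos.preimage (continuous_apply j)
  have hquad : ∀ (n : Type _) [Fintype n] (A B : Matrix n n ℂ) (a b : ℝ) (x : n → ℂ),
      (star x ⬝ᵥ (a • A + b • B) *ᵥ x).re =
        a * (star x ⬝ᵥ A *ᵥ x).re + b * (star x ⬝ᵥ B *ᵥ x).re := by
    intro n _ A B a b x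
    simp [Matrix.add_mulVec, Matrix.smul_mulVec, dotProduct_add, dotProduct_smul]
  have hUc : Convex ℝ U := by
    intro A hA B hB a b ha hb hab j hj x hx
    rw [Pi.add_apply, Pi.smul_apply, Pi.smul_apply, hquad]
    have h1 := hA j hj x hx
    have h2 := hB j hj x hx
    rcases ha.eq_or_lt with rfl | ha
    · have : b = 1 := by linarith
      simpa [this] using h2
    · have := mul_pos ha h1
      have := mul_nonneg hb h2.le
      linarith
  have hCc : Convex ℝ C := by
    rintro _ ⟨R, K, hR, h0, hl, hK, rfl⟩ _ ⟨R', K', hR', h0', hl', hK', rfl⟩ a b ha hb hab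
    refine ⟨a • R + b • R', a • K + b • K', fun j => ?_, ?_, ?_, ?_, (chainSlack_comb ..).symm⟩
    · have : ∀ (c : ℝ) (M : Matrix (Hist Y j × Hist X j) (Hist Y j × Hist X j) ℂ),
          M.IsHermitian → (c • M).IsHermitian := fun c M hM => by
        rw [Matrix.IsHermitian, Matrix.conjTranspose_smul, hM.eq, star_trivial]
      exact (this a _ (hR j)).add (this b _ (hR' j))
    · rw [Pi.add_apply, Pi.smul_apply, Pi.smul_apply, h0, h0', ← add_smul, hab, one_smul]
    · rw [Pi.add_apply, Pi.smul_apply, Pi.smul_apply, hl, hl', overlapOperator_comb]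
    · convert! posSemidef_comb hK hK' ha hb using 1
      rw [Matrix.fromBlocks_smul, Matrix.fromBlocks_smul, Matrix.fromBlocks_add,
        Matrix.conjTranspose_add, Matrix.conjTranspose_smul, Matrix.conjTranspose_smul,
        star_trivial, star_trivial]
      simp only [← add_smul, hab, one_smul]
  have hdisj : Disjoint U C := by
    rw [Set.disjoint_left]
    rintro _ hU ⟨R, K, hR, h0, hl, hK, rfl⟩
    -- A common point would survive a small increase of R 0 in this direction, giving a feasible
    -- value v + ε.
    let D : (j : ℕ) → Matrix (Hist Y j × Hist X j) (Hist Y j × Hist X j) ℂ := Pi.single 0 1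
    have hD : ∀ j, (D j).IsHermitian := by
      intro j
      rcases j with _ | j
      · simp only [D, Pi.single_eq_same]; exact Matrix.isHermitian_one
      · simp only [D, Pi.single_eq_of_ne (Nat.succ_ne_zero j)]; exact Matrix.isHermitian_zero
    have hc : Continuous fun ε : ℝ => (1 : ℝ) • chainSlack r R + ε • chainSlack r D := by
      fun_prop
    have hev : ∀ᶠ ε in nhds (0 : ℝ), (1 : ℝ) • chainSlack r R + ε • chainSlack r D ∈ U := by
      refine hc.continuousAt.eventually (hUo.mem_nhds ?_)
      simpa using hU
    obtain ⟨ε, hε, hεU⟩ : ∃ ε > 0, (1 : ℝ) • chainSlack r R + ε • chainSlack r D ∈ U :=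
      ((hev.filter_mono (nhdsWithin_le_nhds (s := Set.Ioi 0))).and
        self_mem_nhdsWithin).exists.imp fun ε h => ⟨h.2, h.1⟩
    rw [← chainSlack_comb] at hεU
    set R' := (1 : ℝ) • R + ε • D
    have hR' : ∀ j, (R' j).IsHermitian := fun j => by
      have : (ε • D j).IsHermitian := by
        rw [Matrix.IsHermitian, Matrix.conjTranspose_smul, (hD j).eq, star_trivial]
      simpa [R'] using (hR j).add this
    have hfeas : ChainFeasible P Q R' K :=
      { hermitian := fun j _ => hR' j
        step := fun j hj => by
          have h1 := posSemidef_of_sphere (chainSlack_isHermitian (r := r) hR' j) (hεU j hj)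
          rwa [chainSlack, if_pos hj] at h1
        last := by
          have : R' r = R r := by
            simp [R', D, Pi.single_eq_of_ne (show r ≠ 0 by omega)]
          rw [this, hl, sub_self]
          exact Matrix.PosSemidef.zero
        block := hK }
    have := hv ⟨R', K, hfeas.sdpFeasible (t := v + ε) hr (by
      simp only [R', D, Pi.add_apply, Pi.smul_apply, Pi.single_eq_same, h0, one_smul,
        Complex.ofReal_add, add_smul]
      congr 1)⟩
    linarith
  obtain ⟨f, u, hfU, hfC⟩ := geometric_hahn_banach_open hUc hUo hCc hdisj
  let one : (j : ℕ) → Matrix (Hist Y j × Hist X (j + 1)) (Hist Y j × Hist X (j + 1)) ℂ :=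
    fun j => if j < r then 1 else 0
  have hone : ∀ A : (j : ℕ) → Matrix (Hist Y j × Hist X (j + 1)) (Hist Y j × Hist X (j + 1)) ℂ,
      (∀ j, (A j).PosSemidef) → ∀ s : ℝ, 0 < s → (1 : ℝ) • A + s • one ∈ U := by
    intro A hA s hs j hj x hx
    have hx0 : x ≠ 0 := by
      rintro rfl
      simp at hx
    have h1 := (Complex.lt_def.1 (Matrix.PosDef.one.dotProduct_mulVec_pos hx0)).1
    rw [Pi.add_apply, Pi.smul_apply, Pi.smul_apply, hquad]
    simp only [one, if_pos hj]
    have h2 := re_star_dotProduct_mulVec_nonneg (hA j) x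
    have h3 := mul_pos hs h1
    linarith
  have hcone : ∀ A ∈ U, f A ≤ 0 := by
    intro A hA
    by_contra hpos
    push Not at hpos
    have hs : ∀ s : ℝ, 0 < s → s * f A < u := fun s hs => by
      have : s • A ∈ U := fun j hj x hx => by
        have h1 := hquad _ (A j) 0 s 0 x
        simp only [smul_zero, add_zero, zero_mul] at h1
        rw [Pi.smul_apply, h1]
        exact mul_pos hs (hA j hj x hx)
      simpa using hfU _ this
    have h1 := hs ((|u| + 1) / f A) (by positivity)
    rw [div_mul_cancel₀ _ hpos.ne'] at h1
    linarith [le_abs_self u]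
  have hf : ∀ A s, f ((1 : ℝ) • A + s • one) = f A + s * f one := fun A s => by simp
  have hu : 0 ≤ u := by
    by_contra hneg
    push Not at hneg
    have h1 : ∀ s : ℝ, 0 < s → s * f one < u := fun s hs => by
      have := hfU _ (hone 0 (fun _ => Matrix.PosSemidef.zero) s hs)
      simpa [hf] using this
    have h2 := h1 1 one_pos
    have h3 : f one < 0 := by linarith
    have h4 := h1 (u / f one / 2) (half_pos (div_pos_of_neg_of_neg hneg h3))
    rw [div_mul_eq_mul_div, div_mul_cancel₀ _ h3.ne] at h4
    linarith
  have hclosed : ∀ A : (j : ℕ) → Matrix (Hist Y j × Hist X (j + 1)) (Hist Y j × Hist X (j + 1)) ℂ,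
      (∀ j, (A j).PosSemidef) → f A ≤ 0 := by
    intro A hA
    by_contra hpos
    push Not at hpos
    have hd : 0 < |f one| + 1 := by positivity
    have h1 := hcone _ (hone A hA (f A / (|f one| + 1)) (div_pos hpos hd))
    rw [hf, div_mul_eq_mul_div] at h1
    have h2 : -(f A * f one) < f A * (|f one| + 1) := by
      nlinarith [neg_abs_le (f one)]
    have h3 : -(f A * f one) / (|f one| + 1) < f A := (div_lt_iff₀ hd).2 h2
    rw [neg_div] at h3
    linarith
  -- The functional f is nonpositive on positive tuples, so its negative is represented, one
  -- coordinate at a time.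
  choose N hNh hN using fun j => exists_isHermitian_trace_repr
    (-((f : _ →ₗ[ℝ] ℝ) ∘ₗ LinearMap.single ℝ (fun j => Matrix (Hist Y j × Hist X (j + 1))
      (Hist Y j × Hist X (j + 1)) ℂ) j))
  have hsum : ∀ A : (j : ℕ) → Matrix (Hist Y j × Hist X (j + 1)) (Hist Y j × Hist X (j + 1)) ℂ,
      (∀ j, (A j).IsHermitian) → (∀ j, r ≤ j → A j = 0) →
      ∑ j ∈ Finset.range r, (N j * A j).trace.re = -f A := by
    intro A hA h0
    have e : A = ∑ j ∈ Finset.range r, Pi.single j (A j) := by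
      funext i
      rw [Finset.sum_apply]
      by_cases hi : i < r
      · rw [Finset.sum_eq_single i (fun j _ hj => Pi.single_eq_of_ne hj.symm _)
          (fun h => absurd (Finset.mem_range.2 hi) h), Pi.single_eq_same]
      · rw [h0 i (not_lt.1 hi), Finset.sum_eq_zero]
        intro j hj
        exact Pi.single_eq_of_ne (by have := Finset.mem_range.1 hj; omega) _
    conv_rhs => rw [e]
    rw [map_sum, ← Finset.sum_neg_distrib]
    exact Finset.sum_congr rfl fun j _ => (hN j (A j) (hA j)).symm
  refine ⟨N, u, hu, ?_, ?_, ?_⟩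
  · intro j hj
    refine Matrix.PosSemidef.of_dotProduct_mulVec_nonneg (hNh j) fun x => ?_
    rw [Complex.le_def]
    refine ⟨?_, (hNh j).im_star_dotProduct_mulVec_self x |>.symm⟩
    have hx := Matrix.posSemidef_vecMulVec_self_star x
    have h1 := hN j _ hx.isHermitian
    rw [Matrix.mul_vecMulVec, Matrix.trace_vecMulVec, dotProduct_comm] at h1
    have h2 := hclosed (Pi.single j (Matrix.vecMulVec x (star x))) fun i => by
      by_cases hi : i = j
      · subst hi
        rwa [Pi.single_eq_same]
      · rw [Pi.single_eq_of_ne hi]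
        exact Matrix.PosSemidef.zero
    rw [← h1]
    exact neg_nonneg.2 h2
  · have h1 := hsum one (fun j => by
      simp only [one]
      split_ifs
      exacts [Matrix.isHermitian_one, Matrix.isHermitian_zero])
      fun j hj => if_neg (not_lt.2 hj)
    have h2 : ∑ j ∈ Finset.range r, (N j * one j).trace.re =
        ∑ j ∈ Finset.range r, (N j).trace.re :=
      Finset.sum_congr rfl fun j hj => by
        simp only [one, if_pos (Finset.mem_range.1 hj), Matrix.mul_one]
    have h3 := hfU _ (hone 0 (fun _ => Matrix.PosSemidef.zero) 1 one_pos)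
    rw [hf, map_zero] at h3
    linarith
  · intro R K hR h0 hl hK
    have := hsum (chainSlack r R) (chainSlack_isHermitian hR) fun j hj => if_neg (not_lt.2 hj)
    have h2 := hfC _ ⟨R, K, hR, h0, hl, hK, rfl⟩
    have h3 : ∑ j ∈ Finset.range r, (N j * chainSlack r R j).trace.re =
        ∑ j ∈ Finset.range r,
          (N j * (trLastOutput (R (j + 1)) - tensorNextInput (R j))).trace.re :=
      Finset.sum_congr rfl fun j hj => by rw [chainSlack, if_pos (Finset.mem_range.1 hj)]
    linarith

/-- Strong duality: some normalized chain bounds all overlap operators by the optimal value. -/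
theorem exists_chain_le {k z : ℕ} {P Q : PureStrategy X Y (k + 1) z} {v : ℝ}
    (hv : v ∈ upperBounds (sdpValues P Q)) :
    ∃ N : (j : ℕ) → Matrix (Hist Y j × Hist X (j + 1)) (Hist Y j × Hist X (j + 1)) ℂ,
      (∀ j < k + 1, (N j).PosSemidef) ∧ (N 0).trace.re = 1 ∧
      (∀ j, j + 1 < k + 1 → trLastInput (N (j + 1)) = tensorNextOutput (N j)) ∧
      ∀ K, (Matrix.fromBlocks 1 K Kᴴ 1).PosSemidef →
        (tensorNextOutput (N k) * overlapOperator P Q K).trace.re ≤ v := by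
  obtain ⟨N, u, hu, hN, hN1, hNC⟩ := exists_separating_chain (Nat.succ_le_succ k.zero_le) hv
  -- D j is the defect in the chain condition, and the coefficient of the free variable R (j + 1) in
  -- the separating inequality. Taking R (j + 1) = s · D j bounds s times the sum of the ‖D j‖² for
  -- every real s, so all D j vanish.
  let D : (j : ℕ) → Matrix (Hist Y (j + 1) × Hist X (j + 1)) (Hist Y (j + 1) × Hist X (j + 1)) ℂ :=
    fun j => if j < k then tensorNextOutput (N j) - trLastInput (N (j + 1)) else 0
  have hD : ∀ j, (D j).IsHermitian := fun j => by
    by_cases hj : j < k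
    · simp only [D, if_pos hj]
      exact (tensorNextOutput_isHermitian (hN j (by omega)).1).sub
        (trLastInput_isHermitian (hN (j + 1) (by omega)).1)
    · simp only [D, if_neg hj]
      exact Matrix.isHermitian_zero
  have key : ∀ K, (Matrix.fromBlocks 1 K Kᴴ 1).PosSemidef → ∀ s : ℝ,
      (tensorNextOutput (N k) * overlapOperator P Q K).trace.re - v * (N 0).trace.re +
        s * ∑ j ∈ Finset.range k, ((D j)ᴴ * D j).trace.re ≤ -u := by
    intro K hK s
    let R : (j : ℕ) → Matrix (Hist Y j × Hist X j) (Hist Y j × Hist X j) ℂ := fun j =>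
      match j with
      | 0 => (v : ℂ) • 1
      | j + 1 => (s : ℂ) • D j
    have h := hNC (Function.update R (k + 1) (overlapOperator P Q K)) K ?_ ?_ ?_ hK
    · refine le_trans (le_of_eq ?_) h
      set R' := Function.update R (k + 1) (overlapOperator P Q K)
      have hlast : R' (k + 1) = overlapOperator P Q K := Function.update_self ..
      have hzero : R' 0 = (v : ℂ) • 1 := Function.update_of_ne (Nat.succ_ne_zero k).symm ..
      have hmid : ∀ j < k, R' (j + 1) = (s : ℂ) • D j := fun j hj =>
        Function.update_of_ne (by omega) ..
      have hsplit : ∀ j, (N j * (trLastOutput (R' (j + 1)) - tensorNextInput (R' j))).trace.re =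
          (tensorNextOutput (N j) * R' (j + 1)).trace.re -
            (N j * tensorNextInput (R' j)).trace.re := fun j => by
        rw [Matrix.mul_sub, Matrix.trace_sub, Complex.sub_re, trace_tensorNextOutput_mul]
      simp only [hsplit]
      rw [Finset.sum_sub_distrib, Finset.sum_range_succ, Finset.sum_range_succ', hlast, hzero,
        tensorNextInput_smul_one, Matrix.mul_smul, Matrix.mul_one, Matrix.trace_smul, smul_eq_mul,
        Complex.re_ofReal_mul, Finset.mul_sum]
      have hterm : ∀ j ∈ Finset.range k, s * ((D j)ᴴ * D j).trace.re =
          (tensorNextOutput (N j) * R' (j + 1)).trace.re -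
            (N (j + 1) * tensorNextInput (R' (j + 1))).trace.re := fun j hj => by
        have hj := Finset.mem_range.1 hj
        rw [← trace_trLastInput_mul, ← Complex.sub_re, ← Matrix.trace_sub, ← Matrix.sub_mul,
          hmid j hj, Matrix.mul_smul, Matrix.trace_smul, smul_eq_mul, Complex.re_ofReal_mul,
          (hD j).eq]
        simp only [D, if_pos hj]
      rw [Finset.sum_congr rfl hterm, Finset.sum_sub_distrib]
      ring
    · intro j
      by_cases hj : j = k + 1
      · subst hj
        rw [Function.update_self]
        exact overlapOperator_isHermitian P Q K
      · rw [Function.update_of_ne hj, Matrix.IsHermitian]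
        rcases j with _ | j
        · simp [R, Matrix.conjTranspose_smul]
        · simp [R, Matrix.conjTranspose_smul, (hD j).eq]
    · rw [Function.update_of_ne (Nat.succ_ne_zero k).symm]
    · rw [Function.update_self]
  have hK0 : (Matrix.fromBlocks 1 (0 : Matrix (Fin z) (Fin z) ℂ) 0ᴴ 1).PosSemidef :=
    (sdpFeasible_zero P Q).block
  have hDpos : ∀ j, 0 ≤ ((D j)ᴴ * D j).trace.re := fun j =>
    (Complex.le_def.1 (Matrix.posSemidef_conjTranspose_mul_self (D j)).trace_nonneg).1
  have hDsum : ∑ j ∈ Finset.range k, ((D j)ᴴ * D j).trace.re = 0 := by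
    by_contra hne
    have hpos : 0 < ∑ j ∈ Finset.range k, ((D j)ᴴ * D j).trace.re :=
      (Finset.sum_nonneg fun j _ => hDpos j).lt_of_ne' hne
    set c := (tensorNextOutput (N k) * overlapOperator P Q 0).trace.re - v * (N 0).trace.re
    have := key 0 hK0 ((|c| + 1) / ∑ j ∈ Finset.range k, ((D j)ᴴ * D j).trace.re)
    rw [div_mul_cancel₀ _ hpos.ne'] at this
    linarith [neg_abs_le c]
  have hchain : ∀ j, j + 1 < k + 1 → trLastInput (N (j + 1)) = tensorNextOutput (N j) := by
    intro j hj
    have h1 := (Finset.sum_eq_zero_iff_of_nonneg fun j _ => hDpos j).1 hDsum j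
      (Finset.mem_range.2 (by omega))
    have h2 : ((D j)ᴴ * D j).trace = 0 := Complex.ext h1
      (Complex.le_def.1 (Matrix.posSemidef_conjTranspose_mul_self (D j)).trace_nonneg).2.symm
    have h3 : D j = 0 := Matrix.trace_conjTranspose_mul_self_eq_zero_iff.1 h2
    simp only [D, if_pos (show j < k by omega)] at h3
    exact (sub_eq_zero.1 h3).symm
  have htr : ∀ j < k + 1, 0 ≤ (N j).trace.re := fun j hj =>
    (Complex.le_def.1 (hN j hj).trace_nonneg).1
  -- If Tr N_0 = 0, the chain conditions make every N_j zero; then strictness says -u < 0 while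
  -- `key` says 0 ≤ -u.
  have hpos : 0 < (N 0).trace.re := by
    refine (htr 0 k.succ_pos).lt_of_ne' fun h0 => ?_
    have hzero : ∀ j < k + 1, N j = 0 := by
      intro j
      have of_trace : ∀ j < k + 1, (N j).trace = 0 → N j = 0 := fun j hj h => by
        ext p q
        have := (hN j hj).norm_apply_le_trace p q
        rw [h] at this
        exact norm_le_zero_iff.1 this
      induction j with
      | zero =>
        intro hj
        exact of_trace 0 hj (Complex.ext h0 (Complex.le_def.1 (hN 0 hj).trace_nonneg).2.symm)
      | succ j ih =>
        intro hj
        refine of_trace _ hj ?_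
        have h1 := trace_trLastInput_mul (N (j + 1)) 1
        have h2 := tensorNextInput_smul_one (X := X) (Y := Y) (j := j + 1) 1
        rw [one_smul, one_smul] at h2
        rw [h2, Matrix.mul_one, Matrix.mul_one, hchain j hj, ih (by omega)] at h1
        rw [← h1]
        simp [Matrix.trace, tensorNextOutput]
    have h1 := key 0 hK0 0
    rw [hzero k k.lt_succ_self, hzero 0 k.succ_pos] at h1
    have h2 : ∑ j ∈ Finset.range (k + 1), (N j).trace.re = 0 :=
      Finset.sum_eq_zero fun j hj => by rw [hzero j (Finset.mem_range.1 hj)]; simp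
    have h3 : (tensorNextOutput (0 : Matrix (Hist Y k × Hist X (k + 1)) (Hist Y k × Hist X (k + 1)) ℂ) *
        overlapOperator P Q 0).trace.re = 0 := by
      rw [trace_tensorNextOutput_mul]
      simp
    rw [h2] at hN1
    rw [h3] at h1
    simp at h1
    linarith
  let c := (N 0).trace.re
  have hsm : ∀ j, tensorNextOutput (((c⁻¹ : ℝ) : ℂ) • N j) =
      ((c⁻¹ : ℝ) : ℂ) • tensorNextOutput (N j) := fun j => by
    ext p q
    simp [tensorNextOutput, mul_assoc]
  refine ⟨fun j => ((c⁻¹ : ℝ) : ℂ) • N j, fun j hj => ?_, ?_, fun j hj => ?_, fun K hK => ?_⟩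
  · exact (hN j hj).smul (by rw [Complex.zero_le_real]; exact inv_nonneg.2 hpos.le)
  · rw [Matrix.trace_smul, smul_eq_mul, Complex.re_ofReal_mul]
    exact inv_mul_cancel₀ hpos.ne'
  · rw [hsm, ← hchain j hj]
    ext p q
    simp [trLastInput, Finset.mul_sum]
  · have h1 := key K hK 0
    rw [hsm, Matrix.smul_mul, Matrix.trace_smul, smul_eq_mul, Complex.re_ofReal_mul,
      inv_mul_le_iff₀ hpos]
    change _ ≤ (N 0).trace.re * v
    linarith

end Duality

theorem mainTheorem5 {X Y : ℕ → Type*} [∀ i, Fintype (X i)] [∀ i, DecidableEq (X i)]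
    [∀ i, Nonempty (X i)] [∀ i, Fintype (Y i)] [∀ i, DecidableEq (Y i)]
    {r z : ℕ} (hr : 1 ≤ r)
    (S T : Matrix (Hist Y r × Hist X r) (Hist Y r × Hist X r) ℂ)
    (S' T' : PureStrategy X Y r z) (hS : S'.IsPurification S) (hT : T'.IsPurification T) :
    IsLeast (fidelityValues S T) (strategyFidelity S T) ∧
      IsGreatest (sdpValues S' T') (strategyFidelity S T) := by
  obtain ⟨v, hv⟩ := exists_isGreatest_sdpValues hr S' T'
  suffices h : IsLeast (fidelityValues S T) v by
    rw [strategyFidelity, h.csInf_eq]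
    exact ⟨h, hv⟩
  refine ⟨?_, ?_⟩
  · obtain ⟨k, rfl⟩ : ∃ k, r = k + 1 := ⟨r - 1, by omega⟩
    obtain ⟨N, hN, hN0, hNs, hNK⟩ := exists_chain_le hv.2
    obtain ⟨w, B, hB⟩ := exists_pureCoStrategy_gram N hN hN0 hNs
    refine ⟨w, B, z, z, S', T', hS, hT, ?_⟩
    obtain ⟨K, hK, hKB⟩ := exists_re_trace_gram_eq_fidelity S' T' B
    obtain ⟨R, K', hRK⟩ := hv.1
    -- Weak duality gives v ≤ fidelity. The reverse uses the chain bound at the contraction K that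
    -- attains the fidelity for this B.
    refine le_antisymm (hRK.le_fidelity B) ?_
    rw [← hKB, hB]
    exact hNK K hK
  -- P and Q may have other memory dimensions than the given purifications, but the reduced states
  -- see only the Choi operators.
  · rintro _ ⟨w, B, z₁, z₂, P, Q, hP, hQ, rfl⟩
    obtain ⟨R, K, hRK⟩ := hv.1
    have h := hRK.le_fidelity B
    rw [reducedState_eq_choi] at h ⊢
    rw [reducedState_eq_choi] at h ⊢
    rwa [hP.trans hS.symm, hQ.trans hT.symm]
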